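/- Let $\ell\in\{\tfrac12,\tfrac32,\tfrac52,\dots\}$, and let $\mathfrak g_\ell$ be the complex Lie algebra with basis $C,D,H,M,P_0,\dots,P_{2\ell}$, with $M$ central, and whose other non-zero brackets of basis elements are, up to antisymmetry, $$[D,H]=2H,\quad [D,C]=-2C,\quad [C,H]=D,\quad [H,P_n]=-nP_{n-1},\quad [D,P_n]=2(\ell-n)P_n,\quad [C,P_n]=(2\ell-n)P_{n+1},$$ $$[P_m,P_n]=\delta_{m+n,2\ell}\,(-1)^{m+\ell+\frac12}\,m!\,(2\ell-m)!\,M .$$ For $\delta,\mu\in\mathbb R$ let $V^{\delta,\mu}$ be the Verma module generated by a highest weight vector $v$ with $Dv=\delta v$, $Mv=\mu v$ and $Hv=P_0v=\dots=P_{\ell-\frac12}v=0$. For $m\ge 0$ let $V_m$ be the span of the vectors $$C^h\prod_{j=0}^{\ell-\frac12}P_{\ell+\frac12+j}^{k_j}\,v,\qquad h,k_j\in\mathbb Z_{\ge0},\quad 2h+\sum_{j}(2j+1)k_j=m, \tag{$*$}$$ and let $d^\ell_m$ be the number of the labels $(h,k_0,\dots,k_{\ell-\frac12})$ in $(*)$.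 Then $\dim V_m=d^\ell_m$ for all $m,\delta,\mu$. There is a unique sesquilinear form $(\cdot,\cdot)$ on $V^{\delta,\mu}$ (conjugate-linear in the first variable) with $(v,v)=1$ and $(Ax,y)=(x,\omega(A)y)$ for all $A\in\mathfrak g_\ell$ and $x,y\in V^{\delta,\mu}$, where $\omega$ is the conjugate-linear anti-automorphism of $\mathfrak g_\ell$ with $\omega(P_j)=P_{2\ell-j}$, $\omega(C)=H$, $\omega(H)=C$, $\omega(D)=D$, $\omega(M)=M$. Let the Kac determinant $\mathcal D^\ell_m(\delta,\mu)$ be the determinant of the matrix of this form on the basis $(*)$ of $V_m$. For every $\ell$ and every $m\ge 0$ there is a function $f:\mathbb R\to\mathbb R$, independent of $\delta$ and with $f(\mu)\neq0$ for $\mu\ne0$, such that for all real $\delta,\mu$ $$\mathcal D^\ell_m(\delta,\mu)=f(\mu)\prod_{j=0}^{\lfloor m/2\rfloor-1}\Bigl(2\delta-2j+\bigl(\ell+\tfrac12\bigr)^2\Bigr)^{d^\ell_{m-2(j+1)}} .$$ In particular the multiplicities are exact: for each $\mu\neq0$, $\delta\mapsto\mathcal D^\ell_m(\delta,\mu)$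 is a non-zero real polynomial, and for every integer $q$ with $2\le 2q\le m$ the number $\delta=q-1-\tfrac12(\ell+\tfrac12)^2$ is a root of it of multiplicity exactly $d^\ell_{m-2q}$. -/

import Mathlib

open scoped ComplexConjugate

noncomputable section

namespace ConformalGalilei

/-- The standard basis of the centrally extended spin-`ℓ` conformal Galilei algebra in one space
dimension, `ℓ = N + 1/2`: the elements `C`, `D`, `H`, the central element `M`, and
`P n` for `n = 0, 1, …, 2ℓ = 2 N + 1`. -/
inductive Gen (N : ℕ) : Type
  | C : Gen N
  | D : Gen N
  | H : Gen N
  | M : Gen N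
  | P (n : Fin (2 * N + 2)) : Gen N

/-- The underlying complex vector space of the algebra, with basis `Gen N`. -/
def Alg (N : ℕ) : Type := Gen N →₀ ℂ

instance (N : ℕ) : AddCommGroup (Alg N) := inferInstanceAs (AddCommGroup (Gen N →₀ ℂ))

instance (N : ℕ) : Module ℂ (Alg N) := inferInstanceAs (Module ℂ (Gen N →₀ ℂ))

/-- The basis `C, D, H, M, P 0, …, P (2ℓ)` of the algebra. -/
def basis (N : ℕ) : Module.Basis (Gen N) ℂ (Alg N) :=
  Module.Basis.ofRepr (LinearEquiv.refl ℂ (Gen N →₀ ℂ))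

/-- A basis element, as an element of the algebra. -/
def gen {N : ℕ} (i : Gen N) : Alg N := basis N i

/-- The element `P_k`, set to `0` when `k` is outside `0, …, 2 ℓ`. -/
def genP (N k : ℕ) : Alg N := if h : k < 2 * N + 2 then gen (Gen.P ⟨k, h⟩) else 0

/-- `I_m = (-1)^(m + ℓ + 1/2) m! (2ℓ - m)!`, for `0 ≤ m ≤ 2 ℓ`. -/
def centralCoeff (N m : ℕ) : ℂ :=
  (-1) ^ (m + N + 1) * (m.factorial : ℂ) * ((2 * N + 1 - m).factorial : ℂ)

/-- The brackets of the basis elements. -/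
def bracketGen (N : ℕ) : Gen N → Gen N → Alg N
  | .D, .H => (2 : ℂ) • gen .H
  | .H, .D => (-2 : ℂ) • gen .H
  | .D, .C => (-2 : ℂ) • gen .C
  | .C, .D => (2 : ℂ) • gen .C
  | .C, .H => gen .D
  | .H, .C => -gen .D
  | .H, .P n => (-(n : ℕ) : ℂ) • genP N (n - 1)
  | .P n, .H => ((n : ℕ) : ℂ) • genP N (n - 1)
  | .D, .P n => (2 * N + 1 - 2 * (n : ℕ) : ℂ) • genP N n
  | .P n, .D => (-(2 * N + 1 - 2 * (n : ℕ)) : ℂ) • genP N n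
  | .C, .P n => (2 * N + 1 - (n : ℕ) : ℂ) • genP N (n + 1)
  | .P n, .C => (-(2 * N + 1 - (n : ℕ)) : ℂ) • genP N (n + 1)
  | .P m, .P n => if (m : ℕ) + n = 2 * N + 1 then centralCoeff N m • gen .M else 0
  | _, _ => 0

/-- The bilinear extension of `bracketGen`. -/
def bracketLin (N : ℕ) : Alg N →ₗ[ℂ] Alg N →ₗ[ℂ] Alg N :=
  (basis N).constr ℂ fun i => (basis N).constr ℂ (bracketGen N i)

theorem bracketLin_gen {N : ℕ} (i j : Gen N) :
    bracketLin N (gen i) (gen j) = bracketGen N i j := by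
  simp only [bracketLin, gen, Module.Basis.constr_basis]

theorem gen_P {N : ℕ} (n : Fin (2 * N + 2)) : gen (Gen.P n) = genP N n := by
  simp [genP, n.2]

theorem genP_eq_zero {N k : ℕ} (h : 2 * N + 2 ≤ k) : genP N k = 0 := by
  simp [genP, Nat.not_lt.2 h]

theorem centralCoeff_antisymm {N m n : ℕ} (h : m + n = 2 * N + 1) :
    centralCoeff N n = -centralCoeff N m := by
  have h1 : 2 * N + 1 - m = n := by omega
  have h2 : 2 * N + 1 - n = m := by omega
  have h3 : (-1 : ℂ) ^ (m + N + 1) * (-1) ^ (n + N + 1) = -1 := by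
    rw [← pow_add, show m + N + 1 + (n + N + 1) = 2 * (2 * N + 1) + 1 by omega, pow_succ, pow_mul]
    simp
  have h4 : (-1 : ℂ) ^ (n + N + 1) * (-1) ^ (n + N + 1) = 1 := by
    rw [← mul_pow]; simp
  have h5 : (-1 : ℂ) ^ (m + N + 1) = - (-1 : ℂ) ^ (n + N + 1) := by
    linear_combination (-1 : ℂ) ^ (n + N + 1) * h3 - (-1 : ℂ) ^ (m + N + 1) * h4
  simp only [centralCoeff, h1, h2, h5]
  ring

theorem centralCoeff_succ {N m n : ℕ} (h : m + n = 2 * N) :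
    ((n : ℂ) + 1) * centralCoeff N (m + 1) = -((m : ℂ) + 1) * centralCoeff N m := by
  have h1 : 2 * N + 1 - m = n + 1 := by omega
  have h2 : 2 * N + 1 - (m + 1) = n := by omega
  simp only [centralCoeff, h1, h2, Nat.factorial_succ]
  push_cast
  ring

theorem bracketGen_swap {N : ℕ} (i j : Gen N) : bracketGen N i j = -bracketGen N j i := by
  cases i <;> cases j <;> simp [bracketGen]
  case C.P | D.P | P.C | P.D => module
  case P.P m n =>
    rw [add_comm (n : ℕ) m]
    split_ifs with h
    · rw [centralCoeff_antisymm h, neg_smul, neg_neg]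
    · simp

theorem bracketLin_swap {N : ℕ} (x y : Alg N) : bracketLin N x y = -bracketLin N y x := by
  have : bracketLin N = -(bracketLin N).flip :=
    (basis N).ext fun i => (basis N).ext fun j => by
      have := bracketGen_swap i j
      rw [← bracketLin_gen, ← bracketLin_gen] at this
      simpa [gen] using this
  simpa using congrArg (fun f => f x y) this

theorem eq_zero_of_eq_neg {N : ℕ} {x : Alg N} (h : x = -x) : x = 0 := by
  have h2 : (2 : ℂ) • x = 0 := by rw [two_smul]; nth_rewrite 1 [h]; exact neg_add_cancel x
  exact (smul_eq_zero.1 h2).resolve_left two_ne_zero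

theorem bracketLin_D {N : ℕ} (k : ℕ) :
    bracketLin N (gen .D) (genP N k) = (2 * N + 1 - 2 * k : ℂ) • genP N k := by
  by_cases h : k < 2 * N + 2
  · have := bracketLin_gen (N := N) .D (.P ⟨k, h⟩)
    rwa [gen_P] at this
  · simp [genP_eq_zero (not_lt.1 h)]

theorem bracketLin_C {N : ℕ} (k : ℕ) :
    bracketLin N (gen .C) (genP N k) = (2 * N + 1 - k : ℂ) • genP N (k + 1) := by
  by_cases h : k < 2 * N + 2
  · have := bracketLin_gen (N := N) .C (.P ⟨k, h⟩)
    rwa [gen_P] at this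
  · simp [genP_eq_zero (not_lt.1 h), genP_eq_zero (N := N) (k := k + 1) (by omega)]

theorem bracketLin_M {N : ℕ} (x : Alg N) : bracketLin N (gen .M) x = 0 := by
  have : bracketLin N (gen .M) = 0 := (basis N).ext fun j => by
    have := bracketLin_gen (N := N) .M j
    cases j <;> simpa [gen, bracketGen] using this
  rw [this]; rfl

theorem bracketLin_H {N : ℕ} {k : ℕ} (h : k < 2 * N + 2) :
    bracketLin N (gen .H) (genP N k) = (-k : ℂ) • genP N (k - 1) := by
  have := bracketLin_gen (N := N) .H (.P ⟨k, h⟩)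
  rwa [gen_P] at this

theorem bracketLin_P {N : ℕ} (m n : ℕ) :
    bracketLin N (genP N m) (genP N n) =
      if m + n = 2 * N + 1 then centralCoeff N m • gen .M else 0 := by
  by_cases hm : m < 2 * N + 2
  · by_cases hn : n < 2 * N + 2
    · have := bracketLin_gen (N := N) (.P ⟨m, hm⟩) (.P ⟨n, hn⟩)
      rwa [gen_P, gen_P] at this
    · rw [genP_eq_zero (not_lt.1 hn), map_zero, if_neg (by omega)]
  · rw [genP_eq_zero (not_lt.1 hm), map_zero, if_neg (by omega), LinearMap.zero_apply]

/-- The failure of the Jacobi identity. -/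
def jac {N : ℕ} (x y z : Alg N) : Alg N :=
  bracketLin N x (bracketLin N y z) - bracketLin N (bracketLin N x y) z -
    bracketLin N y (bracketLin N x z)

theorem jac_swap {N : ℕ} (x y z : Alg N) : jac x y z = -jac y x z := by
  simp only [jac]
  rw [bracketLin_swap x y, map_neg, LinearMap.neg_apply]
  abel

theorem jac_swap' {N : ℕ} (x y z : Alg N) : jac x y z = -jac x z y := by
  simp only [jac]
  rw [bracketLin_swap y z, map_neg, bracketLin_swap (bracketLin N x y) z,
    bracketLin_swap y (bracketLin N x z)]
  abel

theorem jac_M {N : ℕ} (y z : Alg N) : jac (gen .M) y z = 0 := by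
  simp [jac, bracketLin_M]

theorem jac_self {N : ℕ} (y z : Alg N) : jac y y z = 0 :=
  eq_zero_of_eq_neg (jac_swap y y z)

theorem jac_PPP {N : ℕ} (a b c : ℕ) : jac (genP N a) (genP N b) (genP N c) = 0 := by
  have h (x : Alg N) : bracketLin N x (gen .M) = 0 := by
    rw [bracketLin_swap, bracketLin_M, neg_zero]
  simp only [jac, bracketLin_P]
  split_ifs <;> simp [h, bracketLin_M]

theorem jac_DPP {N : ℕ} (a b : ℕ) : jac (gen .D) (genP N a) (genP N b) = 0 := by
  have h (x : Alg N) : bracketLin N x (gen .M) = 0 := by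
    rw [bracketLin_swap, bracketLin_M, neg_zero]
  simp only [jac, bracketLin_P, bracketLin_D, map_smul, LinearMap.smul_apply]
  split_ifs with hab
  · have : (a : ℂ) + b = 2 * N + 1 := by exact_mod_cast hab
    rw [map_smul, h, smul_zero, zero_sub, ← neg_smul, ← sub_smul]
    rw [show -(2 * N + 1 - 2 * (a : ℂ)) - (2 * N + 1 - 2 * b) = 0 by linear_combination 2 * this,
      zero_smul]
  · simp

theorem jac_CPP {N : ℕ} (a b : ℕ) : jac (gen .C) (genP N a) (genP N b) = 0 := by
  have h (x : Alg N) : bracketLin N x (gen .M) = 0 := by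
    rw [bracketLin_swap, bracketLin_M, neg_zero]
  have h0 : bracketLin N (gen .C) (bracketLin N (genP N a) (genP N b)) = 0 := by
    rw [bracketLin_P]; split_ifs <;> simp [h]
  rw [jac, h0]
  simp only [bracketLin_P, bracketLin_C, map_smul, LinearMap.smul_apply]
  by_cases hab : a + b = 2 * N
  · rw [if_pos (by omega), if_pos (by omega)]
    have h1 := centralCoeff_succ hab
    have : (a : ℂ) + b = 2 * N := by exact_mod_cast hab
    rw [smul_smul, smul_smul, zero_sub, ← neg_smul, ← sub_smul]
    rw [show -((2 * N + 1 - (a : ℂ)) * centralCoeff N (a + 1)) -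
      (2 * N + 1 - (b : ℂ)) * centralCoeff N a = 0 by
        rw [← this]; linear_combination -h1, zero_smul]
  · rw [if_neg (by omega), if_neg (by omega)]
    simp

theorem jac_HPP {N : ℕ} {a b : ℕ} (ha : a < 2 * N + 2) (hb : b < 2 * N + 2) :
    jac (gen .H) (genP N a) (genP N b) = 0 := by
  have h (x : Alg N) : bracketLin N x (gen .M) = 0 := by
    rw [bracketLin_swap, bracketLin_M, neg_zero]
  have h0 : bracketLin N (gen .H) (bracketLin N (genP N a) (genP N b)) = 0 := by
    rw [bracketLin_P]; split_ifs <;> simp [h]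
  rw [jac, h0]
  simp only [bracketLin_P, bracketLin_H ha, bracketLin_H hb, map_smul, LinearMap.smul_apply]
  obtain _ | a := a
  · obtain _ | b := b
    · simp
    · simp; intros; omega
  obtain _ | b := b
  · simp; intros; omega
  by_cases hab : a + 1 + (b + 1) = 2 * N + 2
  · rw [if_pos (by omega), if_pos (by omega)]
    have h1 := centralCoeff_succ (N := N) (m := a) (n := b) (by omega)
    rw [smul_smul, smul_smul, zero_sub, ← neg_smul, ← sub_smul]
    rw [show -(-((a + 1 : ℕ) : ℂ) * centralCoeff N (a + 1 - 1)) -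
      -((b + 1 : ℕ) : ℂ) * centralCoeff N (a + 1) = 0 by
        push_cast; linear_combination h1, zero_smul]
  · rw [if_neg (by omega), if_neg (by omega)]
    simp

theorem jac_CDP {N : ℕ} (a : ℕ) : jac (gen .C) (gen .D) (genP N a) = 0 := by
  simp only [jac, bracketLin_gen, bracketGen, bracketLin_C, bracketLin_D, map_smul,
    LinearMap.smul_apply]
  push_cast
  module

theorem jac_DHP {N : ℕ} {a : ℕ} (ha : a < 2 * N + 2) :
    jac (gen .D) (gen .H) (genP N a) = 0 := by
  simp only [jac, bracketLin_gen, bracketGen, bracketLin_H ha, bracketLin_D, map_smul,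
    LinearMap.smul_apply]
  obtain _ | a := a
  · simp
  · simp only [Nat.add_sub_cancel]
    push_cast
    module

theorem jac_CHP {N : ℕ} {a : ℕ} (ha : a < 2 * N + 2) :
    jac (gen .C) (gen .H) (genP N a) = 0 := by
  simp only [jac, bracketLin_gen, bracketGen, bracketLin_H ha, bracketLin_D, bracketLin_C,
    map_smul]
  have h1 : (2 * N + 1 - (a : ℂ)) • bracketLin N (gen .H) (genP N (a + 1)) =
      ((2 * N + 1 - (a : ℂ)) * (-((a : ℂ) + 1))) • genP N a := by
    by_cases h : a + 1 < 2 * N + 2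
    · rw [bracketLin_H h, smul_smul]; simp
    · have : (a : ℂ) = 2 * N + 1 := by
        have : a = 2 * N + 1 := by omega
        exact_mod_cast this
      simp [this]
  rw [h1]
  obtain _ | a := a
  · simp only [Nat.cast_zero, neg_zero, zero_smul]
    module
  · simp only [Nat.add_sub_cancel]
    push_cast
    module

theorem jac_CDH {N : ℕ} : jac (N := N) (gen .C) (gen .D) (gen .H) = 0 := by
  simp only [jac, bracketLin_gen, bracketGen, map_smul, LinearMap.smul_apply]
  module

theorem jac_C {N : ℕ} (j k : Gen N) : jac (gen .C) (gen j) (gen k) = 0 := by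
  have s1 {x y z : Alg N} (h : jac x y z = 0) : jac y x z = 0 := by rw [jac_swap, h, neg_zero]
  have s2 {x y z : Alg N} (h : jac x y z = 0) : jac x z y = 0 := by rw [jac_swap', h, neg_zero]
  match j, k with
  | .C, _ => exact jac_self _ _
  | _, .C => exact s2 (jac_self _ _)
  | .M, _ => exact s1 (jac_M _ _)
  | _, .M => exact s2 (s1 (jac_M _ _))
  | .D, .D => exact s1 (s2 (jac_self _ _))
  | .D, .H => exact jac_CDH
  | .H, .D => exact s2 jac_CDH
  | .H, .H => exact s1 (s2 (jac_self _ _))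
  | .D, .P n => rw [gen_P]; exact jac_CDP _
  | .P n, .D => rw [gen_P]; exact s2 (jac_CDP _)
  | .H, .P n => rw [gen_P]; exact jac_CHP n.2
  | .P n, .H => rw [gen_P]; exact s2 (jac_CHP n.2)
  | .P m, .P n => rw [gen_P, gen_P]; exact jac_CPP _ _

theorem jac_D {N : ℕ} (j k : Gen N) : jac (gen .D) (gen j) (gen k) = 0 := by
  have s1 {x y z : Alg N} (h : jac x y z = 0) : jac y x z = 0 := by rw [jac_swap, h, neg_zero]
  have s2 {x y z : Alg N} (h : jac x y z = 0) : jac x z y = 0 := by rw [jac_swap', h, neg_zero]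
  match j, k with
  | .C, _ => exact s1 (jac_C _ _)
  | _, .C => exact s2 (s1 (jac_C _ _))
  | .D, _ => exact jac_self _ _
  | _, .D => exact s2 (jac_self _ _)
  | .M, _ => exact s1 (jac_M _ _)
  | _, .M => exact s2 (s1 (jac_M _ _))
  | .H, .H => exact s1 (s2 (jac_self _ _))
  | .H, .P n => rw [gen_P]; exact jac_DHP n.2
  | .P n, .H => rw [gen_P]; exact s2 (jac_DHP n.2)
  | .P m, .P n => rw [gen_P, gen_P]; exact jac_DPP _ _

theorem jac_H {N : ℕ} (j k : Gen N) : jac (gen .H) (gen j) (gen k) = 0 := by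
  have s1 {x y z : Alg N} (h : jac x y z = 0) : jac y x z = 0 := by rw [jac_swap, h, neg_zero]
  have s2 {x y z : Alg N} (h : jac x y z = 0) : jac x z y = 0 := by rw [jac_swap', h, neg_zero]
  match j, k with
  | .C, _ => exact s1 (jac_C _ _)
  | _, .C => exact s2 (s1 (jac_C _ _))
  | .D, _ => exact s1 (jac_D _ _)
  | _, .D => exact s2 (s1 (jac_D _ _))
  | .H, _ => exact jac_self _ _
  | _, .H => exact s2 (jac_self _ _)
  | .M, _ => exact s1 (jac_M _ _)
  | _, .M => exact s2 (s1 (jac_M _ _))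
  | .P m, .P n => rw [gen_P, gen_P]; exact jac_HPP m.2 n.2

theorem jac_gen {N : ℕ} (i j k : Gen N) : jac (gen i) (gen j) (gen k) = 0 := by
  have s1 {x y z : Alg N} (h : jac x y z = 0) : jac y x z = 0 := by rw [jac_swap, h, neg_zero]
  have s2 {x y z : Alg N} (h : jac x y z = 0) : jac x z y = 0 := by rw [jac_swap', h, neg_zero]
  match i, j, k with
  | .C, _, _ => exact jac_C _ _
  | _, .C, _ => exact s1 (jac_C _ _)
  | _, _, .C => exact s2 (s1 (jac_C _ _))
  | .D, _, _ => exact jac_D _ _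
  | _, .D, _ => exact s1 (jac_D _ _)
  | _, _, .D => exact s2 (s1 (jac_D _ _))
  | .H, _, _ => exact jac_H _ _
  | _, .H, _ => exact s1 (jac_H _ _)
  | _, _, .H => exact s2 (s1 (jac_H _ _))
  | .M, _, _ => exact jac_M _ _
  | _, .M, _ => exact s1 (jac_M _ _)
  | _, _, .M => exact s2 (s1 (jac_M _ _))
  | .P a, .P b, .P c => rw [gen_P, gen_P, gen_P]; exact jac_PPP _ _ _

theorem alg_induction {N : ℕ} {p : Alg N → Prop} (hg : ∀ i, p (gen i)) (h0 : p 0)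
    (ha : ∀ x y, p x → p y → p (x + y)) (hs : ∀ (c : ℂ) x, p x → p (c • x)) (x : Alg N) : p x :=
  Submodule.span_induction (p := fun y _ => p y) (by rintro _ ⟨i, rfl⟩; exact hg i) h0
    (fun x y _ _ => ha x y) (fun c x _ => hs c x) ((basis N).mem_span x)

theorem jac_eq_zero {N : ℕ} (x y z : Alg N) : jac x y z = 0 := by
  have hadd (x x' y z : Alg N) : jac (x + x') y z = jac x y z + jac x' y z := by
    simp only [jac, map_add, LinearMap.add_apply]; abel
  have hsm (c : ℂ) (x y z : Alg N) : jac (c • x) y z = c • jac x y z := by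
    simp only [jac, map_smul, LinearMap.smul_apply, smul_sub]
  have h0 (y z : Alg N) : jac 0 y z = 0 := by simp [jac]
  have red (y z : Alg N) (h : ∀ i, jac (gen i) y z = 0) (x : Alg N) : jac x y z = 0 :=
    alg_induction (p := fun x => jac x y z = 0) h (h0 y z) (fun a b ha hb => by rw [hadd, ha, hb, add_zero])
      (fun c a ha => by rw [hsm, ha, smul_zero]) x
  refine red _ _ (fun i => ?_) x
  rw [jac_swap, neg_eq_zero]
  refine red _ _ (fun j => ?_) y
  rw [jac_swap', jac_swap, neg_neg]
  refine red _ _ (fun k => ?_) z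
  exact jac_gen _ _ _

instance (N : ℕ) : LieRing (Alg N) where
  bracket x y := bracketLin N x y
  add_lie x y z := by simp
  lie_add x y z := by simp
  lie_self x := eq_zero_of_eq_neg (bracketLin_swap x x)
  leibniz_lie x y z := by
    have := jac_eq_zero x y z
    rw [jac, sub_sub, sub_eq_zero] at this
    exact this

instance (N : ℕ) : LieAlgebra ℂ (Alg N) where
  toModule := inferInstance
  lie_smul t x y := map_smul (bracketLin N x) t y

/-- The involution of the basis underlying `ω`: it exchanges `C` and `H`, fixes `D` and `M`, and
sends `P j` to `P (2ℓ - j)`. -/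
def omegaGen {N : ℕ} : Gen N → Gen N
  | .C => .H
  | .H => .C
  | .D => .D
  | .M => .M
  | .P j => .P (Fin.rev j)

/-- The anti-automorphism `ω` of the algebra: the conjugate-linear extension of `omegaGen`. -/
def omega {N : ℕ} (x : Alg N) : Alg N :=
  ((basis N).repr x).sum fun i c => conj c • gen (omegaGen i)

theorem omega_gen {N : ℕ} (i : Gen N) : omega (gen i) = gen (omegaGen i) := by
  simp [omega, gen]

theorem omega_add {N : ℕ} (x y : Alg N) : omega (x + y) = omega x + omega y := by
  rw [omega, map_add]
  exact Finsupp.sum_add_index' (by simp) (by simp [add_smul])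

theorem omega_smul {N : ℕ} (c : ℂ) (x : Alg N) : omega (c • x) = conj c • omega x := by
  rw [omega, map_smul, Finsupp.sum_smul_index (by simp), omega, Finsupp.smul_sum]
  simp [mul_smul]

theorem omega_zero {N : ℕ} : omega (0 : Alg N) = 0 := by simp [omega]

theorem omega_omega {N : ℕ} (x : Alg N) : omega (omega x) = x := by
  refine alg_induction (p := fun x => omega (omega x) = x) (fun i => ?_) (by simp [omega_zero]) (fun x y hx hy => ?_)
    (fun c x hx => ?_) x
  · rw [omega_gen, omega_gen]; cases i <;> simp [omegaGen]
  · rw [omega_add, omega_add, hx, hy]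
  · rw [omega_smul, omega_smul, hx, Complex.conj_conj]

theorem omega_genP {N k : ℕ} (hk : k < 2 * N + 2) : omega (genP N k) = genP N (2 * N + 1 - k) := by
  rw [genP, dif_pos hk, omega_gen, omegaGen, gen_P, Fin.val_rev]; congr 1; simp

theorem omega_bracketGen {N : ℕ} (i j : Gen N) :
    omega (bracketGen N i j) = bracketGen N (omegaGen j) (omegaGen i) := by
  have hn (x : Alg N) : omega (-x) = - omega x := by
    have := omega_smul (-1) x; simpa using this
  have hP (n : Fin (2*N+2)) : ((Fin.rev n : ℕ) : ℂ) = 2 * N + 1 - n := by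
    have h := n.2
    rw [Fin.val_rev, show 2 * N + 2 - ((n:ℕ) + 1) = 2 * N + 1 - n by omega, Nat.cast_sub (by omega)]; push_cast; ring
  have e1 (n : Fin (2*N+2)) : ((n:ℕ):ℂ) • omega (genP N ((n:ℕ) - 1)) = ((n:ℕ):ℂ) • genP N ((Fin.rev n : ℕ) + 1) := by
    have h := n.2
    by_cases h0 : (n:ℕ) = 0
    · simp [h0]
    · rw [omega_genP (by omega), Fin.val_rev]; congr 2; omega
  have e2 (n : Fin (2*N+2)) : (2 * N + 1 - ((n:ℕ):ℂ)) • omega (genP N ((n:ℕ) + 1)) = (2 * N + 1 - ((n:ℕ):ℂ)) • genP N ((Fin.rev n : ℕ) - 1) := by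
    have h := n.2
    by_cases h0 : (n:ℕ) = 2 * N + 1
    · simp [h0]
    · rw [omega_genP (by omega), Fin.val_rev]; congr 2; omega
  have e3 (n : Fin (2*N+2)) : omega (genP N n) = genP N (Fin.rev n) := by
    rw [omega_genP n.2, Fin.val_rev]; congr 1; omega
  rcases i with _ | _ | _ | _ | a <;> rcases j with _ | _ | _ | _ | b <;>
    simp only [bracketGen, omegaGen, omega_smul, omega_gen, hn, hP, omega_zero, e3]
  case P.P =>
    simp only [Fin.val_rev]
    have := a.2; have := b.2
    split_ifs with h1 h2 h2
    · rw [omega_smul, omega_gen, omegaGen]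
      congr 1
      rw [show 2 * N + 2 - ((b:ℕ) + 1) = a by omega]
      simp [centralCoeff]
    · omega
    · omega
    · exact omega_zero
  all_goals simp only [map_neg, map_sub, map_add, map_mul, Complex.conj_natCast, map_ofNat, map_one, neg_smul, e1, e2]
  all_goals module

theorem omega_lie {N : ℕ} (x y : Alg N) : omega ⁅x, y⁆ = ⁅omega y, omega x⁆ := by
  refine alg_induction (p := fun x => omega ⁅x, y⁆ = ⁅omega y, omega x⁆) (fun i => ?_)
    (by simp [omega_zero]) (fun a b ha hb => by simp only [add_lie, lie_add, omega_add, ha, hb])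
    (fun c a ha => by simp only [smul_lie, lie_smul, omega_smul, ha]) x
  refine alg_induction (p := fun y => omega ⁅gen i, y⁆ = ⁅omega y, omega (gen i)⁆) (fun j => ?_)
    (by simp [omega_zero]) (fun a b ha hb => by simp only [add_lie, lie_add, omega_add, ha, hb])
    (fun c a ha => by simp only [smul_lie, lie_smul, omega_smul, ha]) y
  have := omega_bracketGen i j
  rw [← bracketLin_gen, ← bracketLin_gen] at this
  rw [omega_gen, omega_gen]
  exact this

/-- The universal enveloping algebra. -/
abbrev U (N : ℕ) : Type := UniversalEnvelopingAlgebra ℂ (Alg N)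

/-- The canonical map of the Lie algebra into its universal enveloping algebra. -/
abbrev toU {N : ℕ} (x : Alg N) : U N := UniversalEnvelopingAlgebra.ι ℂ x

/-- The left ideal of the enveloping algebra generated by the positive part
`H, P 0, …, P (ℓ - 1/2)` and by `D - δ` and `M - μ`. -/
def vermaIdeal (N : ℕ) (δ μ : ℝ) : Submodule (U N) (U N) :=
  Submodule.span (U N)
    ({toU (gen .H),
      toU (gen .D) - algebraMap ℂ (U N) (δ : ℂ),
      toU (gen .M) - algebraMap ℂ (U N) (μ : ℂ)} ∪
      {X | ∃ n : Fin (2 * N + 2), (n : ℕ) ≤ N ∧ X = toU (gen (.P n))})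

/-- The Verma module of highest weight `(δ, μ)`. -/
abbrev Verma (N : ℕ) (δ μ : ℝ) : Type := U N ⧸ vermaIdeal N δ μ

/-- The highest weight vector. -/
def hwv (N : ℕ) (δ μ : ℝ) : Verma N δ μ := Submodule.Quotient.mk (1 : U N)

/-- The labels `(h, k_0, …, k_{ℓ - 1/2})` of the basis vectors of level `m`; equivalently, the
partitions of `m` with parts in `{2} ∪ {1, 3, …, 2ℓ}`. -/
def Label (N m : ℕ) : Type :=
  {p : ℕ × (Fin (N + 1) → ℕ) // 2 * p.1 + ∑ j : Fin (N + 1), (2 * (j : ℕ) + 1) * p.2 j = m}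

instance (N m : ℕ) : DecidableEq (Label N m) := Subtype.instDecidableEq

instance (N m : ℕ) : Finite (Label N m) := by
  refine Set.Finite.to_subtype (s := {p : ℕ × (Fin (N + 1) → ℕ) |
    2 * p.1 + ∑ j : Fin (N + 1), (2 * (j : ℕ) + 1) * p.2 j = m}) ?_
  refine ((Set.finite_Iic m).prod (Set.Finite.pi' fun _ : Fin (N + 1) => Set.finite_Iic m)).subset ?_
  rintro ⟨h, k⟩ hp
  replace hp : 2 * h + ∑ j : Fin (N + 1), (2 * (j : ℕ) + 1) * k j = m := hp
  refine ⟨?_, fun j => ?_⟩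
  · simp only [Set.mem_Iic]; omega
  · have h1 := Finset.single_le_sum (f := fun j : Fin (N + 1) => (2 * (j : ℕ) + 1) * k j)
      (fun _ _ => Nat.zero_le _) (Finset.mem_univ j)
    have h2 : k j ≤ (2 * (j : ℕ) + 1) * k j := Nat.le_mul_of_pos_left _ (by omega)
    simp only [Set.mem_Iic]
    omega

instance (N m : ℕ) : Fintype (Label N m) := Fintype.ofFinite _

/-- `d_m`: the number of basis vectors of level `m`. -/
def dimLevel (N m : ℕ) : ℕ := Fintype.card (Label N m)

/-- The basis vector `C ^ h * ∏ j, P (ℓ + 1/2 + j) ^ (k j)` applied to the highest weight vector. -/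
def vec {N m : ℕ} (δ μ : ℝ) (p : Label N m) : Verma N δ μ :=
  (toU (gen .C) ^ p.1.1 *
    (List.ofFn fun j : Fin (N + 1) => toU (genP N (N + 1 + j)) ^ p.1.2 j).prod) • hwv N δ μ

/-- The subspace of level `m` of the Verma module. -/
def level (N : ℕ) (δ μ : ℝ) (m : ℕ) : Submodule ℂ (Verma N δ μ) :=
  Submodule.span ℂ (Set.range fun p : Label N m => vec δ μ p)

/-- Sesquilinear forms on the Verma module, conjugate-linear in the first variable. -/
abbrev Form (N : ℕ) (δ μ : ℝ) : Type := Verma N δ μ →ₗ⋆[ℂ] Verma N δ μ →ₗ[ℂ] ℂ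

/-- The conditions that define the Shapovalov form. -/
structure IsShapovalov {N : ℕ} {δ μ : ℝ} (B : Form N δ μ) : Prop where
  hwv_hwv : B (hwv N δ μ) (hwv N δ μ) = 1
  contravariant : ∀ (A : Alg N) (x y : Verma N δ μ), B (toU A • x) y = B x (toU (omega A) • y)

/-- The determinant, at level `m`, of the matrix of values of a form on the basis vectors. -/
def kacDet {N : ℕ} {δ μ : ℝ} (B : Form N δ μ) (m : ℕ) : ℂ :=
  (Matrix.of fun p q : Label N m => B (vec δ μ p) (vec δ μ q)).det

/-- The spin `ℓ = N + 1/2`. -/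
def spin (N : ℕ) : ℝ := N + 1 / 2

end ConformalGalilei

end

namespace ConformalGalilei

noncomputable section

attribute [local instance] LieRing.ofAssociativeRing

/-! ### Realizations in associative algebras, and the oscillator `sl₂` -/

section Realization

variable {N : ℕ} {R : Type*} [Ring R] [Algebra ℂ R]

/-! For μ ≠ 0 the Heisenberg generators P_n carry their own copy of `sl₂`: the quadratic expressions
`quadC` and `quadH` have the same brackets with every P_n as C and H. So the Verma module should
look like a Fock space tensored with a Verma module of an `sl₂` that commutes with the P_n. This is
realized on polynomials (`isRealization_model`): each P_n is multiplication by, or a multiple of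
differentiation in, a variable `some j`, and C is multiplication by the variable `none` plus
`quadC`. The Fock vacuum has D-weight −(N+1)²/2 (`lie_quad_vacuum`), so the `sl₂` factor has highest
weight δ + (N+1)²/2, where N + 1 = ℓ + 1/2. This is the source of the shift in the determinant.

On the model the contravariant form makes monomials orthogonal, with explicit norms (`monoNorm`).
The basis vector with label (h, k) is sent to the monomial with these exponents plus monomials of
the same level and lower degree in `none` (`pow_apply_monomial`). The transition matrix is therefore
unitriangular (`det_transition`), and the Kac determinant is the product of the norms
(`kacDet_eq_prod`). The δ-dependent factor with index i occurs once for each label with h > i, and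
removing i + 1 factors C matches these labels with those of level m − 2(i+1) (`card_label_lt`).
Different i give different roots in δ, so the multiplicities are exact.

For μ = 0 the quadratic operators are unavailable. The form then comes from the model where all P_n
act by zero, and the determinant vanishes for m > 0. Independence of the basis vectors is
transported from μ = 1 through a tensor product of Verma modules (`lowerMap`). Uniqueness of the
form is formal: the highest weight vector is orthogonal to the image of every lowering generator. -/

theorem lie_gen {N : ℕ} (i j : Gen N) : ⁅(gen i : Alg N), gen j⁆ = bracketGen N i j :=
  bracketLin_gen i j

omit [Algebra ℂ R] in
theorem mul_commutator (a b x : R) : ⁅a * b, x⁆ = a * ⁅b, x⁆ + ⁅a, x⁆ * b := by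
  simp only [Ring.lie_def]; noncomm_ring

omit [Algebra ℂ R] in
theorem commutator_mul (x a b : R) : ⁅x, a * b⁆ = ⁅x, a⁆ * b + a * ⁅x, b⁆ := by
  simp only [Ring.lie_def]; noncomm_ring

/-- Elements of an associative algebra that satisfy the bracket relations of the conformal Galilei
algebra, with `M` acting as the scalar `μ`. -/
structure IsRealization (N : ℕ) (μ : ℂ) (C D H : R) (P : ℕ → R) : Prop where
  D_H : ⁅D, H⁆ = (2 : ℂ) • H
  D_C : ⁅D, C⁆ = (-2 : ℂ) • C
  C_H : ⁅C, H⁆ = D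
  H_P : ∀ n < 2 * N + 2, ⁅H, P n⁆ = (-n : ℂ) • P (n - 1)
  D_P : ∀ n < 2 * N + 2, ⁅D, P n⁆ = (2 * N + 1 - 2 * n : ℂ) • P n
  C_P : ∀ n < 2 * N + 2, ⁅C, P n⁆ = (2 * N + 1 - n : ℂ) • P (n + 1)
  P_P : ∀ m < 2 * N + 2, ∀ n < 2 * N + 2,
    ⁅P m, P n⁆ = if m + n = 2 * N + 1 then (centralCoeff N m * μ) • (1 : R) else 0
  P_eq_zero : ∀ n, 2 * N + 2 ≤ n → P n = 0

namespace IsRealization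

variable {μ : ℂ} {C D H : R} {P : ℕ → R}

/-- The image of a basis element. -/
def onGen (N : ℕ) (μ : ℂ) (C D H : R) (P : ℕ → R) : Gen N → R
  | .C => C
  | .D => D
  | .H => H
  | .M => algebraMap ℂ R μ
  | .P n => P n

/-- The linear map underlying a realization. -/
def toLinear (N : ℕ) (μ : ℂ) (C D H : R) (P : ℕ → R) : Alg N →ₗ[ℂ] R :=
  (basis N).constr ℂ (onGen N μ C D H P)

theorem toLinear_gen (i : Gen N) :
    toLinear N μ C D H P (gen i) = onGen N μ C D H P i := by
  simp only [toLinear, gen, Module.Basis.constr_basis]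

theorem toLinear_genP (h : IsRealization N μ C D H P) (k : ℕ) :
    toLinear N μ C D H P (genP N k) = P k := by
  by_cases hk : k < 2 * N + 2
  · rw [genP, dif_pos hk, toLinear_gen]; rfl
  · rw [genP_eq_zero (not_lt.1 hk), map_zero, h.P_eq_zero k (not_lt.1 hk)]

theorem toLinear_lie_gen (h : IsRealization N μ C D H P) (i j : Gen N) :
    toLinear N μ C D H P ⁅(gen i : Alg N), gen j⁆ =
      ⁅toLinear N μ C D H P (gen i), toLinear N μ C D H P (gen j)⁆ := by
  have hM (x : R) : ⁅algebraMap ℂ R μ, x⁆ = 0 := by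
    rw [Ring.lie_def, Algebra.commutes, sub_self]
  have hM' (x : R) : ⁅x, algebraMap ℂ R μ⁆ = 0 := by rw [← lie_skew, hM, neg_zero]
  have HP (a : Fin (2 * N + 2)) := h.H_P a a.2
  have DP (a : Fin (2 * N + 2)) := h.D_P a a.2
  have CP (a : Fin (2 * N + 2)) := h.C_P a a.2
  rw [lie_gen, toLinear_gen, toLinear_gen]
  rcases i with _ | _ | _ | _ | a <;> rcases j with _ | _ | _ | _ | b <;>
    simp only [bracketGen, onGen, map_smul, map_neg, map_zero, toLinear_gen, lie_self, hM, hM',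
      h.toLinear_genP, h.D_H, h.D_C, h.C_H, HP, DP, CP]
  case P.P =>
    rw [h.P_P _ a.2 _ b.2]
    split_ifs
    · rw [map_smul, toLinear_gen, onGen, Algebra.algebraMap_eq_smul_one, smul_smul]
    · rw [map_zero]
  -- What remains are the pairs in the opposite order to the relations of `IsRealization`.
  all_goals
    rw [← lie_skew]
    simp only [h.D_H, h.D_C, h.C_H, HP, DP, CP, neg_smul, neg_neg,
      neg_sub]
  all_goals module

/-- The Lie algebra homomorphism given by a realization. -/
def toLieHom (h : IsRealization N μ C D H P) : Alg N →ₗ⁅ℂ⁆ R where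
  toLinearMap := toLinear N μ C D H P
  map_lie' {x y} := by
    change toLinear N μ C D H P ⁅x, y⁆ = ⁅toLinear N μ C D H P x, toLinear N μ C D H P y⁆
    refine alg_induction (p := fun x => toLinear N μ C D H P ⁅x, y⁆ =
      ⁅toLinear N μ C D H P x, toLinear N μ C D H P y⁆) (fun i => ?_) (by simp)
      (fun a b ha hb => by simp only [add_lie, map_add, ha, hb])
      (fun c a ha => by simp only [smul_lie, map_smul, ha]) x
    refine alg_induction (p := fun y => toLinear N μ C D H P ⁅gen i, y⁆ =
      ⁅toLinear N μ C D H P (gen i), toLinear N μ C D H P y⁆) (fun j => ?_) (by simp)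
      (fun a b ha hb => by simp only [lie_add, map_add, ha, hb])
      (fun c a ha => by simp only [lie_smul, map_smul, ha]) y
    exact h.toLinear_lie_gen i j

theorem toLieHom_gen (h : IsRealization N μ C D H P) (i : Gen N) :
    h.toLieHom (gen i) = onGen N μ C D H P i := toLinear_gen i

theorem toLieHom_genP (h : IsRealization N μ C D H P) (k : ℕ) :
    h.toLieHom (genP N k) = P k := h.toLinear_genP k

/-- Adding an `sl₂`-triple that commutes with a realization gives a realization. -/
theorem add (hr : IsRealization N μ C D H P) {c d h : R} (hdh : ⁅d, h⁆ = (2 : ℂ) • h)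
    (hdc : ⁅d, c⁆ = (-2 : ℂ) • c) (hch : ⁅c, h⁆ = d)
    (hcC : ⁅c, C⁆ = 0) (hcH : ⁅c, H⁆ = 0) (hhC : ⁅h, C⁆ = 0) (hhH : ⁅h, H⁆ = 0)
    (hcP : ∀ n, ⁅c, P n⁆ = 0) (hhP : ∀ n, ⁅h, P n⁆ = 0) :
    IsRealization N μ (c + C) (d + D) (h + H) P := by
  have hdP (n) : ⁅d, P n⁆ = 0 := by rw [← hch, lie_lie, hcP, hhP]; simp
  have hdC : ⁅d, C⁆ = 0 := by rw [← hch, lie_lie, hcC, hhC]; simp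
  have hdH : ⁅d, H⁆ = 0 := by rw [← hch, lie_lie, hcH, hhH]; simp
  have hCc : ⁅C, c⁆ = 0 := by rw [← lie_skew, hcC, neg_zero]
  have hCh : ⁅C, h⁆ = 0 := by rw [← lie_skew, hhC, neg_zero]
  have hHc : ⁅H, c⁆ = 0 := by rw [← lie_skew, hcH, neg_zero]
  have hHh : ⁅H, h⁆ = 0 := by rw [← lie_skew, hhH, neg_zero]
  have hDc : ⁅D, c⁆ = 0 := by rw [← hr.C_H, lie_lie, hCc, hHc]; simp
  have hDh : ⁅D, h⁆ = 0 := by rw [← hr.C_H, lie_lie, hCh, hHh]; simp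
  refine ⟨?_, ?_, ?_, fun n hn => ?_, fun n hn => ?_, fun n hn => ?_, hr.P_P, hr.P_eq_zero⟩
  · rw [add_lie, lie_add, lie_add, hdh, hdH, hDh, hr.D_H]; module
  · rw [add_lie, lie_add, lie_add, hdc, hdC, hDc, hr.D_C]; module
  · rw [add_lie, lie_add, lie_add, hch, hcH, hCh, hr.C_H]; module
  · rw [add_lie, hhP, hr.H_P n hn, zero_add]
  · rw [add_lie, hdP, hr.D_P n hn, zero_add]
  · rw [add_lie, hcP, hr.C_P n hn, zero_add]

/-- Input for `add` when μ = 0: with M acting by zero, the P_n may act by zero, and any `sl₂`-module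
then inflates to the whole algebra. -/
theorem zero : IsRealization N 0 (0 : R) 0 0 fun _ => 0 := by
  constructor <;> simp

end IsRealization

/-! ### Quadratic operators in the Heisenberg generators -/

/-- The coefficients of the quadratic realization. -/
def quadCoeff (N n : ℕ) : ℂ := -(2 * N + 1 - n) / centralCoeff N n

/-- The quadratic expression in the `P n` that has the brackets of `C` with them. -/
def quadC (N : ℕ) (μ : ℂ) (P : ℕ → R) : R :=
  (2 * μ)⁻¹ • ∑ n ∈ Finset.range (2 * N + 1), quadCoeff N n • (P (n + 1) * P (2 * N + 1 - n))

/-- The quadratic expression in the `P n` that has the brackets of `H` with them. -/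
def quadH (N : ℕ) (μ : ℂ) (P : ℕ → R) : R :=
  (2 * μ)⁻¹ • ∑ n ∈ Finset.range (2 * N + 1), quadCoeff N n • (P n * P (2 * N - n))

theorem centralCoeff_ne_zero (N m : ℕ) : centralCoeff N m ≠ 0 := by
  simp [centralCoeff, Nat.factorial_ne_zero]

theorem quadCoeff_mul_left {m n : ℕ} (h : m + n = 2 * N) :
    quadCoeff N m * centralCoeff N m = -(n + 1) := by
  have : (m : ℂ) + n = 2 * N := by exact_mod_cast h
  rw [quadCoeff, div_mul_cancel₀ _ (centralCoeff_ne_zero N m), ← this]; ring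

/-- Compared with `quadCoeff_mul_left` for (n, m), this says that the coefficients are symmetric
under m ↔ 2N − m. Hence the two terms surviving in a bracket with a single P are equal, which
explains the prefactor 1/(2μ). -/
theorem quadCoeff_mul_right {m n : ℕ} (h : m + n = 2 * N) :
    quadCoeff N m * centralCoeff N n = -(m + 1) := by
  have h1 := centralCoeff_succ h
  have h2 := centralCoeff_antisymm (N := N) (m := n) (n := m + 1) (by omega)
  have h3 := quadCoeff_mul_left h
  have h4 : ((n : ℂ) + 1) ≠ 0 := by exact_mod_cast n.succ_ne_zero
  apply mul_left_cancel₀ h4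
  linear_combination ((n + 1) * quadCoeff N m) * h2 - quadCoeff N m * h1 + ((m:ℂ) + 1) * h3

/-- By the Leibniz rule, since P_n P_{2N−n} has total weight 2. It is applied with X the commutator
of the two quadratic operators. -/
theorem lie_quadH {μ : ℂ} {P : ℕ → R} {X : R}
    (hX : ∀ m < 2 * N + 2, ⁅X, P m⁆ = (2 * N + 1 - 2 * m : ℂ) • P m) :
    ⁅X, quadH N μ P⁆ = (2 : ℂ) • quadH N μ P := by
  rw [quadH, lie_smul, lie_sum, smul_comm (2 : ℂ), Finset.smul_sum (r := (2 : ℂ))]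
  congr 1
  refine Finset.sum_congr rfl fun n hn => ?_
  rw [Finset.mem_range] at hn
  rw [lie_smul, commutator_mul, hX _ (by omega), hX _ (by omega), smul_mul_assoc, mul_smul_comm,
    ← add_smul, smul_comm, Nat.cast_sub (by omega)]
  congr 1
  push_cast; ring

theorem lie_quadC {μ : ℂ} {P : ℕ → R} {X : R}
    (hX : ∀ m < 2 * N + 2, ⁅X, P m⁆ = (2 * N + 1 - 2 * m : ℂ) • P m) :
    ⁅X, quadC N μ P⁆ = (-2 : ℂ) • quadC N μ P := by
  rw [quadC, lie_smul, lie_sum, smul_comm (-2 : ℂ), Finset.smul_sum (r := (-2 : ℂ))]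
  congr 1
  refine Finset.sum_congr rfl fun n hn => ?_
  rw [Finset.mem_range] at hn
  rw [lie_smul, commutator_mul, hX _ (by omega), hX _ (by omega), smul_mul_assoc, mul_smul_comm,
    ← add_smul, smul_comm, Nat.cast_sub (by omega)]
  congr 1
  push_cast; ring

section
variable {μ : ℂ} {P : ℕ → R} (hμ : μ ≠ 0) (h0 : ∀ n, 2 * N + 2 ≤ n → P n = 0)
  (hP : ∀ m < 2 * N + 2, ∀ n < 2 * N + 2,
    ⁅P m, P n⁆ = if m + n = 2 * N + 1 then (centralCoeff N m * μ) • (1 : R) else 0)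
include hμ hP

/-- The Leibniz rule leaves two terms: P_m pairs with the second factor when n = m and with the
first when n = 2N − m. Either way the other factor is P_{m+1}. -/
theorem quadC_lie (m : ℕ) (hm : m < 2 * N + 2) :
    ⁅quadC N μ P, P m⁆ = (2 * N + 1 - m : ℂ) • P (m + 1) := by
  -- The guard `m ≤ 2 * N` excludes the truncated value 2N − m = 0 at m = 2N + 1.
  have key : ∀ n ∈ Finset.range (2 * N + 1),
      ⁅quadCoeff N n • (P (n + 1) * P (2 * N + 1 - n)), P m⁆ =
      (if n = m then (μ * (2 * N + 1 - m)) • P (m + 1) else 0) +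
      (if n = 2 * N - m ∧ m ≤ 2 * N then (μ * (2 * N + 1 - m)) • P (m + 1) else 0) := by
    intro n hn
    rw [Finset.mem_range] at hn
    rw [smul_lie, mul_commutator, hP _ (by omega) _ hm, hP _ (by omega) _ hm, smul_add]
    congr 1
    · by_cases e : n = m
      · subst e
        obtain ⟨k, hk⟩ : ∃ k, n + k = 2 * N := ⟨2 * N - n, by omega⟩
        have hk' : (n : ℂ) + k = 2 * N := by exact_mod_cast hk
        rw [if_pos (by omega), if_pos rfl, mul_smul_comm, mul_one, smul_smul]
        congr 1
        have := centralCoeff_antisymm (N := N) (m := n) (n := 2 * N + 1 - n) (by omega)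
        rw [this, ← hk']
        linear_combination -μ * quadCoeff_mul_left hk
      · rw [if_neg (by omega), if_neg e]; simp
    · by_cases e : n = 2 * N - m ∧ m ≤ 2 * N
      · obtain ⟨k, hk⟩ : ∃ k, n + k = 2 * N := ⟨2 * N - n, by omega⟩
        obtain rfl : k = m := by omega
        have hk' : (n : ℂ) + k = 2 * N := by exact_mod_cast hk
        rw [if_pos (by omega), if_pos e, smul_mul_assoc, one_mul, smul_smul,
          show 2 * N + 1 - n = k + 1 by omega]
        congr 1
        have := centralCoeff_antisymm (N := N) (m := k) (n := n + 1) (by omega)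
        rw [this, ← hk']
        linear_combination -μ * quadCoeff_mul_right hk
      · rw [if_neg (by omega), if_neg e]; simp
  rw [quadC, smul_lie, sum_lie, Finset.sum_congr rfl key, Finset.sum_add_distrib]
  by_cases hm' : m = 2 * N + 1
  · have : (2 * N + 1 - m : ℂ) = 0 := by rw [hm']; push_cast; ring
    simp [this]
  · have e1 : m ≤ 2 * N := by omega
    simp only [e1, and_true, Finset.sum_ite_eq', Finset.mem_range]
    rw [if_pos (by omega), if_pos (by omega), ← two_smul ℂ, smul_smul, smul_smul]
    congr 1
    field_simp

theorem quadH_lie (m : ℕ) (hm : m < 2 * N + 2) :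
    ⁅quadH N μ P, P m⁆ = (-m : ℂ) • P (m - 1) := by
  have key : ∀ n ∈ Finset.range (2 * N + 1),
      ⁅quadCoeff N n • (P n * P (2 * N - n)), P m⁆ =
      (if n = m - 1 ∧ m ≠ 0 then (μ * (-m)) • P (m - 1) else 0) +
      (if n = 2 * N + 1 - m then (μ * (-m)) • P (m - 1) else 0) := by
    intro n hn
    rw [Finset.mem_range] at hn
    rw [smul_lie, mul_commutator, hP _ (by omega) _ hm, hP _ (by omega) _ hm, smul_add]
    congr 1
    · by_cases e : n = m - 1 ∧ m ≠ 0
      · obtain ⟨k, hk⟩ : ∃ k, n + k = 2 * N := ⟨2 * N - n, by omega⟩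
        obtain rfl : m = n + 1 := by omega
        rw [if_pos (by omega), if_pos e, mul_smul_comm, mul_one, smul_smul,
          show 2 * N - n = k by omega, Nat.add_sub_cancel]
        congr 1
        push_cast
        linear_combination μ * quadCoeff_mul_right hk
      · rw [if_neg (by omega), if_neg e]; simp
    · by_cases e : n = 2 * N + 1 - m
      · obtain ⟨k, hk⟩ : ∃ k, n + k = 2 * N := ⟨2 * N - n, by omega⟩
        obtain rfl : m = k + 1 := by omega
        rw [if_pos (by omega), if_pos e, smul_mul_assoc, one_mul, smul_smul,
          show 2 * N - n = k by omega, Nat.add_sub_cancel]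
        congr 1
        push_cast
        linear_combination μ * quadCoeff_mul_left hk
      · rw [if_neg (by omega), if_neg e]; simp
  rw [quadH, smul_lie, sum_lie, Finset.sum_congr rfl key, Finset.sum_add_distrib]
  by_cases hm' : m = 0
  · simp [hm']
  · simp only [hm', ne_eq, not_false_eq_true, and_true, Finset.sum_ite_eq', Finset.mem_range]
    rw [if_pos (by omega), if_pos (by omega), ← two_smul ℂ, smul_smul, smul_smul]
    congr 1
    field_simp

/-- By the Jacobi identity. It supplies the weight hypothesis of `lie_quadH` and `lie_quadC`, so D
can be taken to be the commutator itself, without any normal ordering. -/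
theorem lie_quad_lie (m : ℕ) (hm : m < 2 * N + 2) :
    ⁅⁅quadC N μ P, quadH N μ P⁆, P m⁆ = (2 * N + 1 - 2 * m : ℂ) • P m := by
  rw [lie_lie, quadH_lie hμ hP m hm, quadC_lie hμ hP m hm, lie_smul, lie_smul,
    quadC_lie hμ hP (m - 1) (by omega)]
  by_cases h : m + 1 < 2 * N + 2
  · rw [quadH_lie hμ hP (m + 1) h]
    obtain _ | m := m
    · simp
    · simp only [Nat.add_sub_cancel]; push_cast; module
  -- Here P_{m+1} is out of range for `quadH_lie`, but its coefficient 2N + 1 − m is zero.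
  · obtain rfl : m = 2 * N + 1 := by omega
    simp only [Nat.add_sub_cancel]
    push_cast
    module

include h0

/-- A representation of the Heisenberg algebra with `μ ≠ 0` extends to the conformal Galilei
algebra. -/
theorem isRealization_quad :
    IsRealization N μ (quadC N μ P) ⁅quadC N μ P, quadH N μ P⁆ (quadH N μ P) P := by
  refine ⟨?_, ?_, rfl, quadH_lie hμ hP, lie_quad_lie hμ hP, quadC_lie hμ hP, hP, h0⟩
  · exact lie_quadH (lie_quad_lie hμ hP)
  · exact lie_quadC (lie_quad_lie hμ hP)

end

end Realization

/-! ### Verma modules: spanning, universal property, contravariant forms -/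

section Verma

variable {N : ℕ} {δ μ : ℝ}

theorem toU_lie (A B : Alg N) : toU ⁅A, B⁆ = toU A * toU B - toU B * toU A :=
  LieHom.map_lie (UniversalEnvelopingAlgebra.ι ℂ) A B

theorem toU_add (A B : Alg N) : toU (A + B) = toU A + toU B :=
  map_add (UniversalEnvelopingAlgebra.ι ℂ) A B

theorem toU_smul (c : ℂ) (A : Alg N) : toU (c • A) = c • toU A :=
  map_smul (UniversalEnvelopingAlgebra.ι ℂ) c A

theorem smul_smul_lie {V : Type*} [AddCommGroup V] [Module (U N) V] (A B : Alg N) (x : V) :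
    toU A • toU B • x = toU B • toU A • x + toU ⁅A, B⁆ • x := by
  rw [toU_lie, sub_smul, mul_smul, mul_smul]; abel

/-- The universal property lifts the canonical map to the subalgebra T cut out by p; composed with
the inclusion of T, the lift is the identity, so T is everything. -/
theorem toU_induction {p : U N → Prop} (hι : ∀ A : Alg N, p (toU A))
    (hc : ∀ c : ℂ, p (algebraMap ℂ (U N) c)) (hadd : ∀ x y, p x → p y → p (x + y))
    (hmul : ∀ x y, p x → p y → p (x * y)) (u : U N) : p u := by
  let T : Subalgebra ℂ (U N) :=
    { carrier := {u | p u}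
      mul_mem' := fun {x y} hx hy => hmul x y hx hy
      add_mem' := fun {x y} hx hy => hadd x y hx hy
      algebraMap_mem' := hc }
  let f : Alg N →ₗ⁅ℂ⁆ T :=
    { toFun := fun A => ⟨toU A, hι A⟩
      map_add' := fun x y => Subtype.ext (toU_add x y)
      map_smul' := fun c x => Subtype.ext (toU_smul c x)
      map_lie' := fun {x y} => Subtype.ext (toU_lie x y) }
  have : T.val.comp (UniversalEnvelopingAlgebra.lift ℂ f) = AlgHom.id ℂ (U N) := by
    refine UniversalEnvelopingAlgebra.hom_ext ℂ (LieHom.ext fun A => ?_)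
    change ((UniversalEnvelopingAlgebra.lift ℂ f (toU A) : T) : U N) = toU A
    rw [UniversalEnvelopingAlgebra.lift_ι_apply]; rfl
  have h2 := DFunLike.congr_fun this u
  change ((UniversalEnvelopingAlgebra.lift ℂ f u : T) : U N) = u at h2
  rw [← h2]
  exact (UniversalEnvelopingAlgebra.lift ℂ f u).2

theorem mk_eq_smul_hwv (u : U N) :
    (Submodule.Quotient.mk u : Verma N δ μ) = u • hwv N δ μ := by
  rw [hwv, ← Submodule.Quotient.mk_smul, smul_eq_mul, mul_one]

theorem eq_top_of_stable {S : Submodule ℂ (Verma N δ μ)} (hv : hwv N δ μ ∈ S)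
    (hS : ∀ (A : Alg N), ∀ x ∈ S, toU A • x ∈ S) : S = ⊤ := by
  have key (u : U N) : ∀ x ∈ S, u • x ∈ S := by
    refine toU_induction (p := fun u => ∀ x ∈ S, u • x ∈ S) hS (fun c x hx => ?_)
      (fun a b ha hb x hx => ?_) (fun a b ha hb x hx => ?_) u
    · rw [algebraMap_smul]; exact S.smul_mem c hx
    · rw [add_smul]; exact S.add_mem (ha x hx) (hb x hx)
    · rw [mul_smul]; exact ha _ (hb x hx)
  refine Submodule.eq_top_iff'.2 fun x => ?_
  obtain ⟨u, rfl⟩ := Submodule.Quotient.mk_surjective _ x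
  rw [mk_eq_smul_hwv]
  exact key u _ hv

theorem smul_hwv_eq_zero {X : U N} (h : X ∈ vermaIdeal N δ μ) : X • hwv N δ μ = 0 := by
  rw [← mk_eq_smul_hwv]; exact (Submodule.Quotient.mk_eq_zero _).2 h

theorem H_smul_hwv : toU (gen (.H : Gen N)) • hwv N δ μ = 0 :=
  smul_hwv_eq_zero (Submodule.subset_span (Or.inl (Or.inl rfl)))

theorem D_smul_hwv : toU (gen (.D : Gen N)) • hwv N δ μ = (δ : ℂ) • hwv N δ μ := by
  rw [← algebraMap_smul (U N), ← sub_eq_zero, ← sub_smul]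
  exact smul_hwv_eq_zero (Submodule.subset_span (Or.inl (Or.inr (Or.inl rfl))))

theorem M_smul_hwv : toU (gen (.M : Gen N)) • hwv N δ μ = (μ : ℂ) • hwv N δ μ := by
  rw [← algebraMap_smul (U N), ← sub_eq_zero, ← sub_smul]
  exact smul_hwv_eq_zero (Submodule.subset_span (Or.inl (Or.inr (Or.inr rfl))))

theorem P_smul_hwv (n : Fin (2 * N + 2)) (hn : (n : ℕ) ≤ N) :
    toU (gen (.P n)) • hwv N δ μ = 0 :=
  smul_hwv_eq_zero (Submodule.subset_span (Or.inr ⟨n, hn, rfl⟩))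

theorem genP_smul_hwv (n : ℕ) (hn : n ≤ N) : toU (genP N n) • hwv N δ μ = 0 := by
  rw [genP, dif_pos (by omega)]; exact P_smul_hwv _ hn

/-- The lowering generators `C` and `P n` with `n ≥ ℓ + 1/2`. -/
def IsLowering : Gen N → Prop
  | .C => True
  | .P n => N + 1 ≤ (n : ℕ)
  | _ => False

theorem exists_smul_hwv (i : Gen N) (hi : ¬ IsLowering i) :
    ∃ c : ℂ, toU (gen i) • hwv N δ μ = c • hwv N δ μ := by
  rcases i with _ | _ | _ | _ | n
  · exact absurd trivial hi
  · exact ⟨_, D_smul_hwv⟩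
  · exact ⟨0, by rw [H_smul_hwv, zero_smul]⟩
  · exact ⟨_, M_smul_hwv⟩
  · exact ⟨0, by rw [P_smul_hwv n (by simp only [IsLowering] at hi; omega), zero_smul]⟩

/-- The vectors obtained from the highest weight vector with at most `r` operators. -/
def filtration (N : ℕ) (δ μ : ℝ) : ℕ → Submodule ℂ (Verma N δ μ)
  | 0 => ℂ ∙ hwv N δ μ
  | r + 1 => filtration N δ μ r ⊔
      Submodule.span ℂ {y | ∃ A : Alg N, ∃ x ∈ filtration N δ μ r, y = toU A • x}

theorem filtration_le_succ (r : ℕ) : filtration N δ μ r ≤ filtration N δ μ (r + 1) := le_sup_left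

theorem smul_mem_filtration_succ {r : ℕ} (A : Alg N) {x : Verma N δ μ}
    (hx : x ∈ filtration N δ μ r) : toU A • x ∈ filtration N δ μ (r + 1) :=
  Submodule.mem_sup_right (Submodule.subset_span ⟨A, x, hx, rfl⟩)

/-- The part of Poincaré–Birkhoff–Witt that is needed: moving a non-lowering generator to the right
costs a commutator acting on a vector of smaller filtration degree, and at the end it scales the
highest weight vector. -/
theorem smul_mem_filtration {r : ℕ} (i : Gen N) (hi : ¬ IsLowering i) {x : Verma N δ μ}
    (hx : x ∈ filtration N δ μ r) : toU (gen i) • x ∈ filtration N δ μ r := by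
  induction r generalizing x with
  | zero =>
    obtain ⟨c, hc⟩ := exists_smul_hwv (δ := δ) (μ := μ) i hi
    obtain ⟨a, rfl⟩ := Submodule.mem_span_singleton.1 hx
    rw [smul_comm, hc]
    exact Submodule.smul_mem _ _ (Submodule.smul_mem _ _ (Submodule.mem_span_singleton_self _))
  | succ r ih =>
    obtain ⟨y, hy, z, hz, rfl⟩ := Submodule.mem_sup.1 hx
    rw [smul_add]
    refine Submodule.add_mem _ (filtration_le_succ r (ih hy)) ?_
    clear hx
    induction hz using Submodule.span_induction with
    | mem z hz =>
      obtain ⟨A, x, hx, rfl⟩ := hz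
      rw [smul_smul_lie]
      exact Submodule.add_mem _ (smul_mem_filtration_succ A (ih hx))
        (smul_mem_filtration_succ _ hx)
    | zero => rw [smul_zero]; exact Submodule.zero_mem _
    | add a b _ _ ha hb => rw [smul_add]; exact Submodule.add_mem _ ha hb
    | smul c a _ ha => rw [smul_comm]; exact Submodule.smul_mem _ c ha

/-- The Verma module is spanned by the highest weight vector and by the images of the lowering
generators. -/
theorem eq_top_of_lowering {S : Submodule ℂ (Verma N δ μ)} (hv : hwv N δ μ ∈ S)
    (hS : ∀ (i : Gen N), IsLowering i → ∀ x, toU (gen i) • x ∈ S) : S = ⊤ := by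
  have h1 (r : ℕ) : filtration N δ μ r ≤ S := by
    induction r with
    | zero => exact (Submodule.span_singleton_le_iff_mem _ _).2 hv
    | succ r ih =>
      refine sup_le ih (Submodule.span_le.2 ?_)
      rintro _ ⟨A, x, hx, rfl⟩
      refine alg_induction (p := fun A => toU A • x ∈ S) (fun i => ?_) (by simp)
        (fun a b ha hb => by rw [toU_add, add_smul]; exact S.add_mem ha hb)
        (fun c a ha => by rw [toU_smul, smul_assoc]; exact S.smul_mem c ha) A
      -- A lowering generator lands in S by hypothesis; any other one stays at filtration degree r,
      -- where the induction hypothesis applies.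
      by_cases hi : IsLowering i
      · exact hS i hi x
      · exact ih (smul_mem_filtration i hi hx)
  have hmono : Monotone (filtration N δ μ) := monotone_nat_of_le_succ filtration_le_succ
  have h2 : ⨆ r, filtration N δ μ r = ⊤ := by
    refine eq_top_of_stable (Submodule.mem_iSup_of_mem 0 (Submodule.mem_span_singleton_self _))
      fun A x hx => ?_
    obtain ⟨r, hr⟩ := (Submodule.mem_iSup_of_directed _ hmono.directed_le).1 hx
    exact Submodule.mem_iSup_of_mem (r + 1) (smul_mem_filtration_succ A hr)
  exact top_le_iff.1 (h2 ▸ iSup_le h1)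

section Lift

variable {V : Type*} [AddCommGroup V] [Module ℂ V]

/-- A highest weight vector for a representation. -/
structure IsHighestWeight (ρ : Alg N →ₗ⁅ℂ⁆ Module.End ℂ V) (δ μ : ℝ) (w : V) : Prop where
  H : ρ (gen .H) w = 0
  D : ρ (gen .D) w = (δ : ℂ) • w
  M : ρ (gen .M) w = (μ : ℂ) • w
  P : ∀ n ≤ N, ρ (genP N n) w = 0

variable {ρ : Alg N →ₗ⁅ℂ⁆ Module.End ℂ V} {w : V}

/-- The annihilator of w is a left ideal, so the generators suffice. Scalars are restricted because
V is given only as a complex vector space. -/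
theorem IsHighestWeight.vermaIdeal_le (h : IsHighestWeight ρ δ μ w) :
    (vermaIdeal N δ μ).restrictScalars ℂ ≤ LinearMap.ker (LinearMap.applyₗ w ∘ₗ
      (UniversalEnvelopingAlgebra.lift ℂ ρ).toLinearMap) := by
  intro u hu
  rw [Submodule.restrictScalars_mem] at hu
  change UniversalEnvelopingAlgebra.lift ℂ ρ u w = 0
  induction hu using Submodule.span_induction with
  | mem u hu =>
    obtain (rfl | rfl | rfl) | ⟨n, hn, rfl⟩ := hu
    · rw [UniversalEnvelopingAlgebra.lift_ι_apply, h.H]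
    · rw [map_sub, UniversalEnvelopingAlgebra.lift_ι_apply, AlgHom.commutes, LinearMap.sub_apply,
        h.D, Module.algebraMap_end_apply, sub_self]
    · rw [map_sub, UniversalEnvelopingAlgebra.lift_ι_apply, AlgHom.commutes, LinearMap.sub_apply,
        h.M, Module.algebraMap_end_apply, sub_self]
    · rw [UniversalEnvelopingAlgebra.lift_ι_apply, gen_P, h.P _ hn]
  | zero => rw [map_zero, LinearMap.zero_apply]
  | add a b _ _ ha hb => rw [map_add, LinearMap.add_apply, ha, hb, add_zero]
  | smul c a _ ha => rw [smul_eq_mul, map_mul, Module.End.mul_apply, ha, map_zero]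

/-- The map from the Verma module given by a highest weight vector of a representation. -/
def IsHighestWeight.lift (h : IsHighestWeight ρ δ μ w) : Verma N δ μ →ₗ[ℂ] V :=
  Submodule.liftQ _ _ h.vermaIdeal_le ∘ₗ
    (Submodule.Quotient.restrictScalarsEquiv ℂ (vermaIdeal N δ μ)).symm.toLinearMap

theorem IsHighestWeight.lift_mk (h : IsHighestWeight ρ δ μ w) (u : U N) :
    h.lift (Submodule.Quotient.mk u) = UniversalEnvelopingAlgebra.lift ℂ ρ u w := rfl

theorem IsHighestWeight.lift_hwv (h : IsHighestWeight ρ δ μ w) : h.lift (hwv N δ μ) = w := by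
  rw [hwv, h.lift_mk, map_one, Module.End.one_apply]

theorem IsHighestWeight.lift_smul (h : IsHighestWeight ρ δ μ w) (A : Alg N) (x : Verma N δ μ) :
    h.lift (toU A • x) = ρ A (h.lift x) := by
  obtain ⟨u, rfl⟩ := Submodule.Quotient.mk_surjective _ x
  rw [← Submodule.Quotient.mk_smul, h.lift_mk, h.lift_mk, smul_eq_mul, map_mul,
    UniversalEnvelopingAlgebra.lift_ι_apply, Module.End.mul_apply]

end Lift

theorem IsShapovalov.apply_smul {B : Form N δ μ} (hB : IsShapovalov B) (A : Alg N)
    (x y : Verma N δ μ) : B x (toU A • y) = B (toU (omega A) • x) y := by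
  rw [hB.contravariant, omega_omega]

theorem omegaGen_smul_hwv {i : Gen N} (hi : IsLowering i) :
    toU (gen (omegaGen i)) • hwv N δ μ = 0 := by
  rcases i with _ | _ | _ | _ | n
  · exact H_smul_hwv
  · exact hi.elim
  · exact hi.elim
  · exact hi.elim
  · refine P_smul_hwv _ ?_
    simp only [IsLowering] at hi
    rw [Fin.val_rev]; omega

/-- The highest weight vector is orthogonal to the image of a lowering generator. -/
theorem IsShapovalov.hwv_lowering {B : Form N δ μ} (hB : IsShapovalov B) {i : Gen N}
    (hi : IsLowering i) (x : Verma N δ μ) : B (hwv N δ μ) (toU (gen i) • x) = 0 := by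
  rw [hB.apply_smul, omega_gen, omegaGen_smul_hwv hi, map_zero, LinearMap.zero_apply]

/-- The functional B(v, ·) is 1 at v and zero on images of lowering generators, hence determined.
Contravariance then propagates equality to every first argument, as v is cyclic. -/
theorem IsShapovalov.unique {B B' : Form N δ μ} (hB : IsShapovalov B) (hB' : IsShapovalov B') :
    B = B' := by
  let K : Submodule ℂ (Verma N δ μ) :=
    LinearMap.ker (B (hwv N δ μ) - B' (hwv N δ μ) : Verma N δ μ →ₗ[ℂ] ℂ)
  have hK (y) : y ∈ K ↔ B (hwv N δ μ) y = B' (hwv N δ μ) y := by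
    rw [LinearMap.mem_ker, LinearMap.sub_apply, sub_eq_zero]
  have h1 : K = ⊤ := by
    refine eq_top_of_lowering ?_ fun i hi x => ?_
    · rw [hK, hB.hwv_hwv, hB'.hwv_hwv]
    · rw [hK, hB.hwv_lowering hi, hB'.hwv_lowering hi]
  let S : Submodule ℂ (Verma N δ μ) :=
    { carrier := {x | ∀ y, B x y = B' x y}
      add_mem' := fun {a b} ha hb y => by
        rw [map_add, map_add, LinearMap.add_apply, LinearMap.add_apply, ha y, hb y]
      zero_mem' := fun y => by rw [map_zero, map_zero]
      smul_mem' := fun c a ha y => by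
        rw [map_smulₛₗ, map_smulₛₗ, LinearMap.smul_apply, LinearMap.smul_apply, ha y] }
  have h2 : S = ⊤ := by
    refine eq_top_of_stable (fun y => (hK y).1 (h1 ▸ Submodule.mem_top)) fun A x hx y => ?_
    rw [hB.contravariant, hB'.contravariant]
    exact hx _
  exact LinearMap.ext fun x => LinearMap.ext fun y =>
    (show x ∈ S from h2 ▸ Submodule.mem_top) y

/-- The pull-back of a sesquilinear form along a linear map. -/
def pullback {V W : Type*} [AddCommGroup V] [Module ℂ V] [AddCommGroup W] [Module ℂ W]
    (f : W →ₗ[ℂ] V) (b : V →ₗ⋆[ℂ] V →ₗ[ℂ] ℂ) : W →ₗ⋆[ℂ] W →ₗ[ℂ] ℂ where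
  toFun x := b (f x) ∘ₗ f
  map_add' x y := by rw [map_add, map_add, LinearMap.add_comp]
  map_smul' c x := by rw [map_smul, map_smulₛₗ, LinearMap.smul_comp]

theorem pullback_apply {V W : Type*} [AddCommGroup V] [Module ℂ V] [AddCommGroup W] [Module ℂ W]
    (f : W →ₗ[ℂ] V) (b : V →ₗ⋆[ℂ] V →ₗ[ℂ] ℂ) (x y : W) : pullback f b x y = b (f x) (f y) := rfl

/-- The pull-back of a contravariant form along the map given by a highest weight vector. -/
theorem IsHighestWeight.isShapovalov {V : Type*} [AddCommGroup V] [Module ℂ V]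
    {ρ : Alg N →ₗ⁅ℂ⁆ Module.End ℂ V} {w : V} (h : IsHighestWeight ρ δ μ w)
    {b : V →ₗ⋆[ℂ] V →ₗ[ℂ] ℂ} (hw : b w w = 1)
    (hb : ∀ i x y, b (ρ (gen i) x) y = b x (ρ (gen (omegaGen i)) y)) :
    IsShapovalov (pullback h.lift b) where
  hwv_hwv := by
    rw [pullback_apply, h.lift_hwv, hw]
  contravariant A x y := by
    simp only [pullback_apply, h.lift_smul]
    generalize h.lift x = x
    generalize h.lift y = y
    refine alg_induction (p := fun A => b (ρ A x) y = b x (ρ (omega A) y)) (fun i => ?_) ?_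
      (fun a b ha hb => ?_) (fun c a ha => ?_) A
    · rw [omega_gen, hb]
    · simp [omega_zero]
    · simp only [omega_add, map_add, LinearMap.add_apply, ha, hb]
    · simp only [omega_smul, map_smul, LinearMap.smul_apply, map_smulₛₗ, ha]

/-! ### Tensor products, and comparison of Verma modules with different weights -/

/-- The tensor product of two representations. -/
def tensorRep {V W : Type*} [AddCommGroup V] [Module ℂ V] [AddCommGroup W] [Module ℂ W]
    (ρ : Alg N →ₗ⁅ℂ⁆ Module.End ℂ V) (σ : Alg N →ₗ⁅ℂ⁆ Module.End ℂ W) :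
    Alg N →ₗ⁅ℂ⁆ Module.End ℂ (TensorProduct ℂ V W) where
  toFun A := (ρ A).rTensor W + (σ A).lTensor V
  map_add' A B := by
    rw [map_add, map_add, LinearMap.rTensor_add, LinearMap.lTensor_add]; abel
  map_smul' c A := by
    rw [map_smul, map_smul, LinearMap.rTensor_smul, LinearMap.lTensor_smul, smul_add]; rfl
  map_lie' {A B} := by
    refine TensorProduct.ext' fun v w => ?_
    simp only [LieHom.map_lie, Ring.lie_def, Module.End.mul_apply, LinearMap.add_apply,
      LinearMap.sub_apply, LinearMap.rTensor_tmul, LinearMap.lTensor_tmul, map_add,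
      TensorProduct.sub_tmul, TensorProduct.tmul_sub]
    abel

theorem tensorRep_tmul {V W : Type*} [AddCommGroup V] [Module ℂ V] [AddCommGroup W] [Module ℂ W]
    (ρ : Alg N →ₗ⁅ℂ⁆ Module.End ℂ V) (σ : Alg N →ₗ⁅ℂ⁆ Module.End ℂ W) (A : Alg N) (v : V) (w : W) :
    tensorRep ρ σ A (v ⊗ₜ[ℂ] w) = ρ A v ⊗ₜ[ℂ] w + v ⊗ₜ[ℂ] σ A w := rfl

/-- The representation on the Verma module. -/
def vermaRep (N : ℕ) (δ μ : ℝ) : Alg N →ₗ⁅ℂ⁆ Module.End ℂ (Verma N δ μ) :=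
  ((Algebra.lsmul ℂ ℂ (Verma N δ μ) : U N →ₐ[ℂ] _) : U N →ₗ⁅ℂ⁆ _).comp
    (UniversalEnvelopingAlgebra.ι ℂ)

theorem vermaRep_apply (A : Alg N) (x : Verma N δ μ) : vermaRep N δ μ A x = toU A • x := rfl

theorem isHighestWeight_hwv : IsHighestWeight (vermaRep N δ μ) δ μ (hwv N δ μ) where
  H := H_smul_hwv
  D := D_smul_hwv
  M := M_smul_hwv
  P := genP_smul_hwv

theorem isHighestWeight_tensor {δ' μ' : ℝ} : IsHighestWeight
    (tensorRep (vermaRep N δ μ) (vermaRep N δ' μ')) (δ + δ') (μ + μ')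
    (hwv N δ μ ⊗ₜ[ℂ] hwv N δ' μ') where
  H := by
    rw [tensorRep_tmul, isHighestWeight_hwv.H, isHighestWeight_hwv.H]; simp
  D := by
    rw [tensorRep_tmul, isHighestWeight_hwv.D, isHighestWeight_hwv.D, TensorProduct.tmul_smul,
      ← TensorProduct.smul_tmul', ← add_smul, Complex.ofReal_add]
  M := by
    rw [tensorRep_tmul, isHighestWeight_hwv.M, isHighestWeight_hwv.M, TensorProduct.tmul_smul,
      ← TensorProduct.smul_tmul', ← add_smul, Complex.ofReal_add]
  P n hn := by
    rw [tensorRep_tmul, isHighestWeight_hwv.P n hn, isHighestWeight_hwv.P n hn]; simp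

/-- A linear map that commutes with the lowering generators. -/
def lowerMap (δ μ : ℝ) {δ' μ' : ℝ} (B : Form N δ' μ') :
    Verma N (δ + δ') (μ + μ') →ₗ[ℂ] Verma N δ μ :=
  (TensorProduct.rid ℂ _).toLinearMap ∘ₗ (B (hwv N δ' μ')).lTensor _ ∘ₗ
    (isHighestWeight_tensor (δ := δ) (μ := μ)).lift

theorem lowerMap_hwv {δ' μ' : ℝ} {B : Form N δ' μ'} (hB : IsShapovalov B) :
    lowerMap δ μ B (hwv N _ _) = hwv N δ μ := by
  simp [lowerMap, IsHighestWeight.lift_hwv, hB.hwv_hwv]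

/-- A generator acts on the tensor product as A ⊗ 1 + 1 ⊗ A. Contraction with B(v', ·) kills the
second summand, because v' is orthogonal to images of lowering generators. -/
theorem lowerMap_smul {δ' μ' : ℝ} {B : Form N δ' μ'} (hB : IsShapovalov B) {i : Gen N}
    (hi : IsLowering i) (x : Verma N (δ + δ') (μ + μ')) :
    lowerMap δ μ B (toU (gen i) • x) = toU (gen i) • lowerMap δ μ B x := by
  simp only [lowerMap, LinearMap.comp_apply, IsHighestWeight.lift_smul]
  generalize isHighestWeight_tensor.lift x = t
  induction t using TensorProduct.induction_on with
  | zero => simp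
  | add a b ha hb => simp only [map_add, smul_add, ha, hb]
  | tmul a b =>
    rw [tensorRep_tmul, map_add, LinearMap.lTensor_tmul, LinearMap.lTensor_tmul,
      LinearMap.lTensor_tmul, vermaRep_apply, vermaRep_apply, hB.hwv_lowering hi,
      TensorProduct.tmul_zero, add_zero, LinearEquiv.coe_coe, TensorProduct.rid_tmul,
      TensorProduct.rid_tmul, smul_comm]

/-- Basis vectors involve lowering generators only, so f need not be a module homomorphism. This
generality is what `lowerMap` requires. -/
theorem map_vec {V : Type*} [AddCommGroup V] [Module ℂ V] {ρ : Gen N → Module.End ℂ V}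
    (f : Verma N δ μ →ₗ[ℂ] V) (hf : ∀ i, IsLowering i → ∀ x, f (toU (gen i) • x) = ρ i (f x))
    {m : ℕ} (p : Label N m) :
    f (vec δ μ p) = (ρ .C ^ p.1.1) ((List.ofFn fun j : Fin (N + 1) =>
      ρ (.P ⟨N + 1 + j, by omega⟩) ^ p.1.2 j).prod (f (hwv N δ μ))) := by
  have hpow (i : Gen N) (hi : IsLowering i) (k : ℕ) (x : Verma N δ μ) :
      f (toU (gen i) ^ k • x) = (ρ i ^ k) (f x) := by
    induction k with
    | zero => simp
    | succ k ih => rw [pow_succ', pow_succ', mul_smul, hf i hi, ih, Module.End.mul_apply]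
  have hlist (l : List (Fin (N + 1))) (k : Fin (N + 1) → ℕ) (x : Verma N δ μ) :
      f ((l.map fun j : Fin (N + 1) => toU (genP N (N + 1 + j)) ^ k j).prod • x) =
        (l.map fun j : Fin (N + 1) => ρ (.P ⟨N + 1 + j, by omega⟩) ^ k j).prod (f x) := by
    induction l with
    | nil => simp
    | cons j l ih =>
      rw [List.map_cons, List.map_cons, List.prod_cons, List.prod_cons, mul_smul,
        Module.End.mul_apply, ← ih, genP, dif_pos (by omega)]
      exact hpow _ (Nat.le_add_right _ _) _ _
  rw [vec, mul_smul, hpow .C trivial, List.ofFn_eq_map, List.ofFn_eq_map, hlist]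

theorem lowerMap_vec {δ' μ' : ℝ} {B : Form N δ' μ'} (hB : IsShapovalov B) {m : ℕ}
    (p : Label N m) : lowerMap δ μ B (vec _ _ p) = vec δ μ p := by
  rw [map_vec (ρ := fun i => vermaRep N δ μ (gen i)) (lowerMap δ μ B)
    fun i hi x => lowerMap_smul hB hi x, lowerMap_hwv hB]
  symm
  exact map_vec (ρ := fun i => vermaRep N δ μ (gen i)) LinearMap.id (fun i hi x => rfl) p

end Verma

/-! ### Centralizers of the quadratic operators, and their action on a vacuum -/

section Quad

variable {N : ℕ} {R : Type*} [Ring R] [Algebra ℂ R] {μ : ℂ} {P : ℕ → R}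

theorem lie_quadC_eq_zero {x : R} (h : ∀ n < 2 * N + 2, ⁅x, P n⁆ = 0) : ⁅x, quadC N μ P⁆ = 0 := by
  rw [quadC, lie_smul, lie_sum, Finset.sum_eq_zero, smul_zero]
  intro n hn
  rw [Finset.mem_range] at hn
  rw [lie_smul, commutator_mul, h _ (by omega), h _ (by omega)]; simp

theorem lie_quadH_eq_zero {x : R} (h : ∀ n < 2 * N + 2, ⁅x, P n⁆ = 0) : ⁅x, quadH N μ P⁆ = 0 := by
  rw [quadH, lie_smul, lie_sum, Finset.sum_eq_zero, smul_zero]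
  intro n hn
  rw [Finset.mem_range] at hn
  rw [lie_smul, commutator_mul, h _ (by omega), h _ (by omega)]; simp

end Quad

section Vacuum

variable {N : ℕ} {V : Type*} [AddCommGroup V] [Module ℂ V] {μ : ℂ} {P : ℕ → Module.End ℂ V} {w : V}
  (hP : ∀ m < 2 * N + 2, ∀ n < 2 * N + 2, ⁅P m, P n⁆ =
    if m + n = 2 * N + 1 then (centralCoeff N m * μ) • (1 : Module.End ℂ V) else 0)
  (hw : ∀ n ≤ N, P n w = 0)

theorem apply_apply_eq (A B : Module.End ℂ V) (w : V) : A (B w) = B (A w) + ⁅A, B⁆ w := by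
  rw [Ring.lie_def, LinearMap.sub_apply, Module.End.mul_apply, Module.End.mul_apply]; abel

include hP hw

/-- In each product the indices add up to 2N, so one of the factors annihilates w, and the two
commute. -/
theorem quadH_vacuum : quadH N μ P w = 0 := by
  rw [quadH, LinearMap.smul_apply, LinearMap.sum_apply, Finset.sum_eq_zero, smul_zero]
  intro n hn
  rw [Finset.mem_range] at hn
  rw [LinearMap.smul_apply, Module.End.mul_apply]
  by_cases h : 2 * N - n ≤ N
  · rw [hw _ h, map_zero, smul_zero]
  · rw [apply_apply_eq, hw n (by omega), hP _ (by omega) _ (by omega), if_neg (by omega)]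
    simp

/-- The indices in each product add up to 2N + 2. Unless both equal N + 1, one factor annihilates w
and commutes with the other. -/
theorem quadC_vacuum :
    quadC N μ P w = ((2 * μ)⁻¹ * quadCoeff N N) • P (N + 1) (P (N + 1) w) := by
  rw [quadC, LinearMap.smul_apply, LinearMap.sum_apply, Finset.sum_eq_single N]
  · rw [LinearMap.smul_apply, Module.End.mul_apply, smul_smul, show 2 * N + 1 - N = N + 1 by omega]
  · intro n hn hN
    rw [Finset.mem_range] at hn
    rw [LinearMap.smul_apply, Module.End.mul_apply]
    by_cases h : 2 * N + 1 - n ≤ N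
    · rw [hw _ h, map_zero, smul_zero]
    · rw [apply_apply_eq, hw (n + 1) (by omega), hP _ (by omega) _ (by omega), if_neg (by omega)]
      simp
  · intro h; exact absurd (Finset.mem_range.2 (by omega)) h

/-- The zero-point weight of the oscillators. Only −`quadH` applied to a multiple of P_{N+1}² w
contributes; `quadH` turns one P_{N+1} into −(N+1) P_N, which is then contracted with the other. -/
theorem lie_quad_vacuum (hμ : μ ≠ 0) :
    ⁅quadC N μ P, quadH N μ P⁆ w = (-((N + 1) ^ 2 / 2) : ℂ) • w := by
  have e (x : V) := apply_apply_eq (quadH N μ P) (P (N + 1)) x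
  have e0 := quadH_lie hμ hP (N + 1) (by omega)
  rw [Nat.add_sub_cancel] at e0
  have e1 : quadH N μ P (P (N + 1) w) = 0 := by
    rw [e, quadH_vacuum hP hw, e0, LinearMap.smul_apply, hw N le_rfl]; simp
  have e2 : P N (P (N + 1) w) = (centralCoeff N N * μ) • w := by
    rw [apply_apply_eq, hw N le_rfl, hP _ (by omega) _ (by omega), if_pos (by omega)]; simp
  rw [Ring.lie_def, LinearMap.sub_apply, Module.End.mul_apply, Module.End.mul_apply,
    quadH_vacuum hP hw, map_zero, quadC_vacuum hP hw, map_smul, e, e1, e0, LinearMap.smul_apply, e2,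
    map_zero, zero_add, zero_sub, smul_smul, smul_smul, ← neg_smul]
  congr 1
  have := quadCoeff_mul_left (N := N) (m := N) (n := N) (by omega)
  field_simp
  push_cast
  linear_combination ((N : ℂ) + 1) * this

end Vacuum

theorem end_lie_smul {V : Type*} [AddCommGroup V] [Module ℂ V] (c : ℂ) (A B : Module.End ℂ V) :
    ⁅A, c • B⁆ = c • ⁅A, B⁆ := by
  rw [Ring.lie_def, Ring.lie_def, mul_smul_comm, smul_mul_assoc, smul_sub]

theorem smul_end_lie {V : Type*} [AddCommGroup V] [Module ℂ V] (c : ℂ) (A B : Module.End ℂ V) :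
    ⁅c • A, B⁆ = c • ⁅A, B⁆ := by
  rw [Ring.lie_def, Ring.lie_def, mul_smul_comm, smul_mul_assoc, smul_sub]

/-! ### The polynomial model: a Verma module of `sl₂` tensored with a Fock space -/

section Model

open MvPolynomial

/-- The space of the model: the variable `none` carries a Verma module of `sl₂`, and the variables
`some j` carry a Fock space. -/
abbrev Poly (N : ℕ) : Type := MvPolynomial (Option (Fin (N + 1))) ℂ

variable {N : ℕ}

/-- Multiplication by a variable. -/
def mulX (i : Option (Fin (N + 1))) : Module.End ℂ (Poly N) := LinearMap.mulLeft ℂ (X i)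

/-- The partial derivative with respect to a variable. -/
def dX (i : Option (Fin (N + 1))) : Module.End ℂ (Poly N) := (pderiv i).toLinearMap

theorem mulX_apply (i : Option (Fin (N + 1))) (f : Poly N) : mulX i f = X i * f := rfl

theorem dX_apply (i : Option (Fin (N + 1))) (f : Poly N) : dX i f = pderiv i f := rfl

theorem mulX_mulX (i j : Option (Fin (N + 1))) : ⁅mulX i, mulX j⁆ = 0 := by
  refine LinearMap.ext fun f => ?_
  simp only [Ring.lie_def, LinearMap.sub_apply, Module.End.mul_apply, mulX_apply,
    LinearMap.zero_apply]
  ring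

theorem dX_dX (i j : Option (Fin (N + 1))) : ⁅dX i, dX j⁆ = 0 := by
  have : ⁅(pderiv i : Derivation ℂ (Poly N) (Poly N)), (pderiv j : Derivation ℂ (Poly N) (Poly N))⁆ = 0 := by
    refine MvPolynomial.derivation_ext fun k => ?_
    classical
    rw [Derivation.commutator_apply, pderiv_X, pderiv_X]
    simp [Pi.single_apply, apply_ite]
  refine LinearMap.ext fun f => ?_
  exact DFunLike.congr_fun this f

theorem dX_mulX (i j : Option (Fin (N + 1))) : ⁅dX i, mulX j⁆ = if i = j then 1 else 0 := by
  classical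
  refine LinearMap.ext fun f => ?_
  rw [Ring.lie_def, LinearMap.sub_apply, Module.End.mul_apply, Module.End.mul_apply, mulX_apply,
    dX_apply, pderiv_mul, pderiv_X, mulX_apply, dX_apply]
  split_ifs with h
  · subst h; simp
  · simp [Pi.single_eq_of_ne (Ne.symm h)]

theorem mulX_dX (i j : Option (Fin (N + 1))) : ⁅mulX i, dX j⁆ = if i = j then -1 else 0 := by
  rw [← lie_skew, dX_mulX]
  by_cases h : i = j
  · subst h; simp
  · rw [if_neg h, if_neg (Ne.symm h), neg_zero]

/-- The operators `P n` on the Fock space. -/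
def fockP (N : ℕ) (μ : ℂ) (n : ℕ) : Module.End ℂ (Poly N) :=
  if n ≤ N then (centralCoeff N n * μ) • dX (some ⟨N - n, by omega⟩)
  else if h : n < 2 * N + 2 then mulX (some ⟨n - N - 1, by omega⟩) else 0

theorem fockP_creation {μ : ℂ} (j : Fin (N + 1)) : fockP N μ (N + 1 + j) = mulX (some j) := by
  rw [fockP, if_neg (by omega), dif_pos (by omega)]
  congr 3; omega

theorem fockP_annihilation {μ : ℂ} (j : Fin (N + 1)) :
    fockP N μ (N - j) = (centralCoeff N (N - j) * μ) • dX (some j) := by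
  rw [fockP, if_pos (by omega)]
  congr 4; omega

theorem eq_creation_or_annihilation {n : ℕ} (hn : n < 2 * N + 2) :
    (∃ j : Fin (N + 1), n = N - j) ∨ ∃ j : Fin (N + 1), n = N + 1 + j := by
  by_cases h : n ≤ N
  · exact Or.inl ⟨⟨N - n, by omega⟩, by simp only; omega⟩
  · exact Or.inr ⟨⟨n - N - 1, by omega⟩, by simp only; omega⟩

theorem fockP_eq_zero {μ : ℂ} {n : ℕ} (hn : 2 * N + 2 ≤ n) : fockP N μ n = 0 := by
  rw [fockP, if_neg (by omega), dif_neg (by omega)]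

theorem fockP_fockP {μ : ℂ} (m : ℕ) (hm : m < 2 * N + 2) (n : ℕ) (hn : n < 2 * N + 2) :
    ⁅fockP N μ m, fockP N μ n⁆ =
      if m + n = 2 * N + 1 then (centralCoeff N m * μ) • (1 : Module.End ℂ (Poly N)) else 0 := by
  obtain ⟨i, rfl⟩ | ⟨i, rfl⟩ := eq_creation_or_annihilation hm <;>
  obtain ⟨j, rfl⟩ | ⟨j, rfl⟩ := eq_creation_or_annihilation hn <;>
  simp only [fockP_creation, fockP_annihilation]
  · rw [end_lie_smul, smul_end_lie, dX_dX, smul_zero, smul_zero, if_neg (by omega)]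
  · rw [smul_end_lie, dX_mulX]
    by_cases h : i = j
    · subst h; rw [if_pos rfl, if_pos (by omega)]
    · rw [if_neg (by simpa using h), if_neg, smul_zero]
      intro h2; apply h; ext; omega
  · rw [end_lie_smul, mulX_dX]
    by_cases h : i = j
    · subst h
      rw [if_pos rfl, if_pos (by omega), centralCoeff_antisymm (m := N - i) (n := N + 1 + i)
        (by omega)]
      module
    · rw [if_neg (by simpa using h), if_neg, smul_zero]
      intro h2; apply h; ext; omega
  · rw [mulX_mulX, if_neg (by omega)]

/-- The `sl₂` raising operator `H` in the variable `none`. -/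
def slH (N : ℕ) (δ : ℂ) : Module.End ℂ (Poly N) :=
  mulX none * dX none * dX none - δ • dX none

/-- The `sl₂` weight operator `D` in the variable `none`. -/
def slD (N : ℕ) (δ : ℂ) : Module.End ℂ (Poly N) :=
  δ • 1 - (2 : ℂ) • (mulX none * dX none)

/-- In one variable x, the operators x, x∂² − δ∂ and δ − 2x∂ give the `sl₂` Verma module of highest
weight δ, with x^h in the role of C^h v. -/
theorem mulX_slH (δ : ℂ) : ⁅(mulX none : Module.End ℂ (Poly N)), slH N δ⁆ = slD N δ := by
  have h := mulX_dX (N := N) none none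
  rw [if_pos rfl] at h
  rw [slH, lie_sub, end_lie_smul, commutator_mul, commutator_mul, mulX_mulX, h, slD,
    zero_mul, zero_add]
  have e1 : ((mulX none * -1 : Module.End ℂ (Poly N))) * dX none = -(mulX none * dX none) := by
    refine LinearMap.ext fun f => ?_
    simp [Module.End.mul_apply]
  have e2 : (mulX none * dX none * -1 : Module.End ℂ (Poly N)) = -(mulX none * dX none) := by
    refine LinearMap.ext fun f => ?_
    simp [Module.End.mul_apply]
  rw [e1, e2]
  module

theorem slD_mulX (δ : ℂ) : ⁅slD N δ, (mulX none : Module.End ℂ (Poly N))⁆ = (-2 : ℂ) • mulX none := by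
  have h := dX_mulX (N := N) none none
  rw [if_pos rfl] at h
  rw [slD, sub_lie, smul_end_lie, smul_end_lie, mul_commutator, h, mulX_mulX, Ring.lie_def,
    one_mul, mul_one, sub_self, zero_mul]
  module

theorem slD_slH (δ : ℂ) : ⁅slD N δ, slH N δ⁆ = (2 : ℂ) • slH N δ := by
  have h := mulX_dX (N := N) none none
  have h' := dX_mulX (N := N) none none
  rw [if_pos rfl] at h h'
  have h1 : ⁅slD N δ, (dX none : Module.End ℂ (Poly N))⁆ = (2 : ℂ) • dX none := by
    rw [slD, sub_lie, smul_end_lie, smul_end_lie, mul_commutator, h, dX_dX, Ring.lie_def,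
      one_mul, mul_one, sub_self, mul_zero]
    have e : (-1 * dX none : Module.End ℂ (Poly N)) = -dX none := by
      refine LinearMap.ext fun f => ?_
      simp [Module.End.mul_apply]
    rw [e]
    module
  rw [slH, lie_sub, end_lie_smul, commutator_mul, commutator_mul, slD_mulX, h1]
  simp only [smul_mul_assoc, mul_smul_comm, add_mul]
  module

theorem mulX_fockP {μ : ℂ} (n : ℕ) : ⁅(mulX none : Module.End ℂ (Poly N)), fockP N μ n⁆ = 0 := by
  by_cases hn : n < 2 * N + 2
  · obtain ⟨i, rfl⟩ | ⟨i, rfl⟩ := eq_creation_or_annihilation hn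
    · rw [fockP_annihilation, end_lie_smul, mulX_dX]; simp
    · rw [fockP_creation, mulX_mulX]
  · rw [fockP_eq_zero (not_lt.1 hn), lie_zero]

theorem dX_fockP {μ : ℂ} (n : ℕ) : ⁅(dX none : Module.End ℂ (Poly N)), fockP N μ n⁆ = 0 := by
  by_cases hn : n < 2 * N + 2
  · obtain ⟨i, rfl⟩ | ⟨i, rfl⟩ := eq_creation_or_annihilation hn
    · rw [fockP_annihilation, end_lie_smul, dX_dX, smul_zero]
    · rw [fockP_creation, dX_mulX]; simp
  · rw [fockP_eq_zero (not_lt.1 hn), lie_zero]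

theorem slH_fockP {δ μ : ℂ} (n : ℕ) : ⁅slH N δ, fockP N μ n⁆ = 0 := by
  rw [slH, sub_lie, smul_end_lie, mul_commutator, mul_commutator, mulX_fockP, dX_fockP]
  simp

/-- The `sl₂` acting in the variable `none` commutes with all P_n, hence with the oscillator `sl₂`
built from them. -/
theorem isRealization_model (δ : ℂ) {μ : ℂ} (hμ : μ ≠ 0) :
    IsRealization N μ (mulX none + quadC N μ (fockP N μ))
      (slD N δ + ⁅quadC N μ (fockP N μ), quadH N μ (fockP N μ)⁆)
      (slH N δ + quadH N μ (fockP N μ)) (fockP N μ) :=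
  (isRealization_quad hμ (fun _ => fockP_eq_zero) fockP_fockP).add (slD_slH δ) (slD_mulX δ)
    (mulX_slH δ) (lie_quadC_eq_zero fun n _ => mulX_fockP n)
    (lie_quadH_eq_zero fun n _ => mulX_fockP n) (lie_quadC_eq_zero fun n _ => slH_fockP n)
    (lie_quadH_eq_zero fun n _ => slH_fockP n) mulX_fockP slH_fockP

theorem isRealization_model_zero (N : ℕ) (δ : ℂ) :
    IsRealization N 0 (mulX none + 0) (slD N δ + 0) (slH N δ + 0) (fun _ => 0) :=
  IsRealization.zero.add (slD_slH δ) (slD_mulX δ) (mulX_slH δ) (lie_zero _) (lie_zero _)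
    (lie_zero _) (lie_zero _) (fun _ => lie_zero _) (fun _ => lie_zero _)

theorem dX_one (i : Option (Fin (N + 1))) : dX i (1 : Poly N) = 0 := by
  rw [dX_apply, pderiv_one]

theorem slH_one (δ : ℂ) : slH N δ 1 = 0 := by
  rw [slH, LinearMap.sub_apply, LinearMap.smul_apply, Module.End.mul_apply, dX_one]; simp

theorem slD_one (δ : ℂ) : slD N δ 1 = δ • 1 := by
  rw [slD, LinearMap.sub_apply, LinearMap.smul_apply, LinearMap.smul_apply, Module.End.mul_apply,
    dX_one]
  simp

theorem fockP_one {μ : ℂ} (n : ℕ) (hn : n ≤ N) : fockP N μ n 1 = 0 := by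
  rw [fockP, if_pos hn, LinearMap.smul_apply, dX_one, smul_zero]

/-- The `sl₂` weight of the model of a Verma module with `μ ≠ 0`. -/
def shift (N : ℕ) (δ : ℝ) : ℝ := δ + (N + 1) ^ 2 / 2

/-- The `sl₂` factor is given weight `shift N δ` so that adding the zero-point weight −(N+1)²/2
leaves δ. -/
theorem isHighestWeight_model (δ : ℝ) {μ : ℝ} (hμ : (μ : ℂ) ≠ 0) :
    IsHighestWeight (isRealization_model (N := N) (shift N δ : ℝ) hμ).toLieHom δ μ 1 where
  H := by
    rw [IsRealization.toLieHom_gen, IsRealization.onGen, LinearMap.add_apply, slH_one,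
      quadH_vacuum fockP_fockP fockP_one, add_zero]
  D := by
    rw [IsRealization.toLieHom_gen, IsRealization.onGen, LinearMap.add_apply, slD_one,
      lie_quad_vacuum fockP_fockP fockP_one hμ, ← add_smul, shift]
    congr 1
    push_cast; ring
  M := by
    rw [IsRealization.toLieHom_gen, IsRealization.onGen, Module.algebraMap_end_apply]
  P n hn := by rw [IsRealization.toLieHom_genP, fockP_one n hn]

theorem isHighestWeight_model_zero (N : ℕ) (δ : ℝ) :
    IsHighestWeight (isRealization_model_zero N δ).toLieHom δ 0 1 where
  H := by
    rw [IsRealization.toLieHom_gen, IsRealization.onGen, add_zero, slH_one]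
  D := by
    rw [IsRealization.toLieHom_gen, IsRealization.onGen, add_zero, slD_one]
  M := by
    rw [IsRealization.toLieHom_gen, IsRealization.onGen, Module.algebraMap_end_apply,
      Complex.ofReal_zero]
  P n hn := by rw [IsRealization.toLieHom_genP, LinearMap.zero_apply]

end Model

/-! ### The contravariant form on the polynomial model -/

section

open MvPolynomial

variable {N : ℕ}

/-- The real number `I_m`. -/
def realCoeff (N m : ℕ) : ℝ :=
  (-1) ^ (m + N + 1) * (m.factorial : ℝ) * ((2 * N + 1 - m).factorial : ℝ)

theorem ofReal_realCoeff (m : ℕ) : ((realCoeff N m : ℝ) : ℂ) = centralCoeff N m := by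
  simp [realCoeff, centralCoeff]

theorem realCoeff_ne_zero (N m : ℕ) : realCoeff N m ≠ 0 := by
  simp [realCoeff, Nat.factorial_ne_zero]

theorem conj_centralCoeff (m : ℕ) : conj (centralCoeff N m) = centralCoeff N m := by
  rw [← ofReal_realCoeff, Complex.conj_ofReal]

theorem conj_quadCoeff (n : ℕ) : conj (quadCoeff N n) = quadCoeff N n := by
  simp [quadCoeff, conj_centralCoeff, map_ofNat (starRingEnd ℂ) 2]

/-- The squared norm of the vector with label `(h, k)`. -/
def labelNorm (N : ℕ) (δ μ : ℝ) (h : ℕ) (k : Fin (N + 1) → ℕ) : ℝ :=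
  ((h.factorial : ℝ) * ∏ i ∈ Finset.range h, ((i : ℝ) - δ)) *
    ∏ j : Fin (N + 1), ((k j).factorial : ℝ) * (realCoeff N (N - j) * μ) ^ k j

/-- The squared norm of a monomial. -/
def monoNorm (δ μ : ℝ) (s : Option (Fin (N + 1)) →₀ ℕ) : ℝ :=
  labelNorm N δ μ (s none) fun j => s (some j)

/-- The ratio of consecutive norms is the coefficient with which `slH` lowers the exponent of
`none`; this is what makes `slH` adjoint to multiplication. -/
theorem monoNorm_add_none (δ μ : ℝ) (s : Option (Fin (N + 1)) →₀ ℕ) :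
    monoNorm δ μ (s + Finsupp.single none 1) =
      (s none + 1) * (s none - δ) * monoNorm δ μ s := by
  simp only [monoNorm, labelNorm, Finsupp.add_apply, Finsupp.single_eq_same, Nat.factorial_succ,
    Finset.prod_range_succ, Finsupp.single_apply, reduceCtorEq, if_false, add_zero]
  push_cast
  ring

/-- The analogous recursion in a Fock variable, which makes the annihilation operator adjoint to the
creation operator. -/
theorem monoNorm_add_some (δ μ : ℝ) (s : Option (Fin (N + 1)) →₀ ℕ) (j : Fin (N + 1)) :
    monoNorm δ μ (s + Finsupp.single (some j) 1) =
      (s (some j) + 1) * (realCoeff N (N - j) * μ) * monoNorm δ μ s := by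
  classical
  simp only [monoNorm, labelNorm, Finsupp.add_apply]
  rw [Finsupp.single_eq_of_ne (by simp), add_zero,
    ← Finset.mul_prod_erase Finset.univ _ (Finset.mem_univ j),
    ← Finset.mul_prod_erase Finset.univ (fun j : Fin (N + 1) => ((s (some j)).factorial : ℝ) *
      (realCoeff N (N - j) * μ) ^ s (some j)) (Finset.mem_univ j)]
  have : ∏ x ∈ Finset.univ.erase j, (((s (some x) + Finsupp.single (some j) 1 (some x)).factorial
      : ℕ) : ℝ) * (realCoeff N (N - x) * μ) ^ (s (some x) + Finsupp.single (some j) 1 (some x)) =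
      ∏ x ∈ Finset.univ.erase j, ((s (some x)).factorial : ℝ) *
        (realCoeff N (N - x) * μ) ^ s (some x) := by
    refine Finset.prod_congr rfl fun x hx => ?_
    rw [Finsupp.single_eq_of_ne (by simpa using Finset.ne_of_mem_erase hx), add_zero]
  rw [this, Finsupp.single_eq_same, Nat.factorial_succ, pow_succ]
  push_cast
  ring

/-- The bilinear form for which the monomials are orthogonal. -/
def polyBilin (N : ℕ) (δ μ : ℝ) : Poly N →ₗ[ℂ] Poly N →ₗ[ℂ] ℂ :=
  (basisMonomials _ ℂ).constr ℂ fun s => (monoNorm δ μ s : ℂ) • lcoeff ℂ s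

theorem polyBilin_monomial (δ μ : ℝ) (s : Option (Fin (N + 1)) →₀ ℕ) (f : Poly N) :
    polyBilin N δ μ (monomial s 1) f = monoNorm δ μ s * coeff s f := by
  have : (monomial s 1 : Poly N) = basisMonomials _ ℂ s := by rw [coe_basisMonomials]
  rw [polyBilin, this, Module.Basis.constr_basis]
  rfl

/-- The sesquilinear form for which the monomials are orthogonal. -/
def polyForm (N : ℕ) (δ μ : ℝ) : Poly N →ₗ⋆[ℂ] Poly N →ₗ[ℂ] ℂ where
  toFun f := polyBilin N δ μ (map (starRingEnd ℂ) f)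
  map_add' f g := by rw [map_add, map_add]
  map_smul' c f := by rw [smul_eq_C_mul, map_mul, map_C, ← smul_eq_C_mul, map_smul]

theorem polyForm_monomial_left (δ μ : ℝ) (s : Option (Fin (N + 1)) →₀ ℕ) (f : Poly N) :
    polyForm N δ μ (monomial s 1) f = monoNorm δ μ s * coeff s f := by
  change polyBilin N δ μ (map (starRingEnd ℂ) (monomial s 1)) f = _
  rw [map_monomial, map_one, polyBilin_monomial]

theorem polyForm_monomial [DecidableEq (Option (Fin (N + 1)) →₀ ℕ)] (δ μ : ℝ)
    (s t : Option (Fin (N + 1)) →₀ ℕ) :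
    polyForm N δ μ (monomial s 1) (monomial t 1) = if s = t then (monoNorm δ μ s : ℂ) else 0 := by
  rw [polyForm_monomial_left, coeff_monomial]
  by_cases h : s = t
  · rw [if_pos h, if_pos h.symm, mul_one]
  · rw [if_neg h, if_neg (Ne.symm h), mul_zero]

theorem polyForm_one (δ μ : ℝ) : polyForm N δ μ 1 1 = 1 := by
  have : (1 : Poly N) = monomial 0 1 := rfl
  rw [this, polyForm_monomial_left, coeff_monomial, if_pos rfl]
  simp [monoNorm, labelNorm]

theorem poly_induction {p : Poly N → Prop} (hm : ∀ s, p (monomial s 1))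
    (ha : ∀ f g, p f → p g → p (f + g)) (hs : ∀ (c : ℂ) f, p f → p (c • f)) (f : Poly N) : p f := by
  refine MvPolynomial.monomial_add_induction_on f ?_ ?_
  · intro a
    have := hs a _ (hm 0)
    rwa [smul_monomial, smul_eq_mul, mul_one] at this
  · intro s a f _ _ hf
    refine ha _ _ ?_ hf
    have := hs a _ (hm s)
    rwa [smul_monomial, smul_eq_mul, mul_one] at this

/-- Adjoint operators for the form `polyForm`. -/
def IsAdj (δ μ : ℝ) (A A' : Module.End ℂ (Poly N)) : Prop :=
  ∀ f g, polyForm N δ μ (A f) g = polyForm N δ μ f (A' g)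

namespace IsAdj

variable {δ μ : ℝ} {A A' B B' : Module.End ℂ (Poly N)}

theorem of_monomial (h : ∀ s t, polyForm N δ μ (A (monomial s 1)) (monomial t 1) =
    polyForm N δ μ (monomial s 1) (A' (monomial t 1))) : IsAdj δ μ A A' := by
  intro f g
  refine poly_induction (p := fun f => polyForm N δ μ (A f) g = polyForm N δ μ f (A' g)) (fun s => ?_) (fun f f' hf hf' => ?_) (fun c f hf => ?_) f
  · refine poly_induction (p := fun g => polyForm N δ μ (A (monomial s 1)) g =
      polyForm N δ μ (monomial s 1) (A' g)) (h s) (fun f f' hf hf' => ?_) (fun c f hf => ?_) g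
    · rw [map_add, map_add, map_add, hf, hf']
    · rw [map_smul, map_smul, map_smul, hf]
  · rw [map_add, map_add, map_add, LinearMap.add_apply, LinearMap.add_apply, hf, hf']
  · rw [map_smul, map_smulₛₗ, map_smulₛₗ, LinearMap.smul_apply, LinearMap.smul_apply, hf]

theorem zero : IsAdj δ μ (0 : Module.End ℂ (Poly N)) 0 := fun f g => by simp

theorem add (h : IsAdj δ μ A A') (h' : IsAdj δ μ B B') : IsAdj δ μ (A + B) (A' + B') := fun f g => by
  rw [LinearMap.add_apply, LinearMap.add_apply, map_add, map_add, LinearMap.add_apply, h, h']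

theorem sub (h : IsAdj δ μ A A') (h' : IsAdj δ μ B B') : IsAdj δ μ (A - B) (A' - B') := fun f g => by
  rw [LinearMap.sub_apply, LinearMap.sub_apply, map_sub, map_sub, LinearMap.sub_apply, h, h']

theorem smul (c : ℂ) (hc : conj c = c) (h : IsAdj δ μ A A') : IsAdj δ μ (c • A) (c • A') :=
  fun f g => by
    rw [LinearMap.smul_apply, LinearMap.smul_apply, map_smulₛₗ (polyForm N δ μ), hc,
      LinearMap.smul_apply, h, map_smul (polyForm N δ μ f)]

theorem mul (h : IsAdj δ μ A A') (h' : IsAdj δ μ B B') : IsAdj δ μ (A * B) (B' * A') := fun f g => by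
  rw [Module.End.mul_apply, Module.End.mul_apply, h, h']

theorem lie (h : IsAdj δ μ A A') (h' : IsAdj δ μ B B') : IsAdj δ μ ⁅A, B⁆ ⁅B', A'⁆ := by
  rw [Ring.lie_def, Ring.lie_def]
  exact (h.mul h').sub (h'.mul h)

theorem sum {ι : Type*} (s : Finset ι) {F F' : ι → Module.End ℂ (Poly N)}
    (h : ∀ i ∈ s, IsAdj δ μ (F i) (F' i)) : IsAdj δ μ (∑ i ∈ s, F i) (∑ i ∈ s, F' i) := by
  classical
  induction s using Finset.induction_on with
  | empty => exact zero
  | insert i s hi ih =>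
    rw [Finset.sum_insert hi, Finset.sum_insert hi]
    exact (h i (Finset.mem_insert_self i s)).add
      (ih fun j hj => h j (Finset.mem_insert_of_mem hj))

end IsAdj

/-- The form is Hermitian since the norms are real; adjointness of two operators is therefore a
symmetric relation. -/
theorem polyForm_conj (δ μ : ℝ) (f g : Poly N) :
    polyForm N δ μ f g = conj (polyForm N δ μ g f) := by
  classical
  refine poly_induction (p := fun f => polyForm N δ μ f g = conj (polyForm N δ μ g f))
    (fun s => ?_) (fun f f' hf hf' => ?_) (fun c f hf => ?_) f
  · refine poly_induction (p := fun g => polyForm N δ μ (monomial s 1) g =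
      conj (polyForm N δ μ g (monomial s 1))) (fun t => ?_) (fun f f' hf hf' => ?_) (fun c f hf => ?_) g
    · rw [polyForm_monomial, polyForm_monomial]
      by_cases h : s = t
      · subst h; simp
      · rw [if_neg h, if_neg (Ne.symm h), map_zero]
    · rw [map_add, map_add, LinearMap.add_apply, map_add, hf, hf']
    · rw [map_smul, map_smulₛₗ, LinearMap.smul_apply, smul_eq_mul, smul_eq_mul, map_mul, hf,
        Complex.conj_conj]
  · rw [map_add, map_add, LinearMap.add_apply, map_add, hf, hf']
  · rw [map_smulₛₗ (polyForm N δ μ), map_smul (polyForm N δ μ g), LinearMap.smul_apply, smul_eq_mul,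
      smul_eq_mul, map_mul, hf]

theorem IsAdj.symm {δ μ : ℝ} {A A' : Module.End ℂ (Poly N)} (h : IsAdj δ μ A A') :
    IsAdj δ μ A' A := fun f g => by
  rw [polyForm_conj, ← h, ← polyForm_conj]

theorem mulX_monomial (i : Option (Fin (N + 1))) (s : Option (Fin (N + 1)) →₀ ℕ) :
    mulX i (monomial s 1) = monomial (s + Finsupp.single i 1) 1 := by
  rw [mulX_apply, X, monomial_mul, one_mul, add_comm s]

theorem dX_monomial (i : Option (Fin (N + 1))) (s : Option (Fin (N + 1)) →₀ ℕ) :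
    dX i (monomial s 1) = (s i : ℂ) • monomial (s - Finsupp.single i 1) 1 := by
  rw [dX_apply, pderiv_monomial, smul_monomial, smul_eq_mul, one_mul, mul_one]

theorem dX_monomial_eq_zero {i : Option (Fin (N + 1))} {s : Option (Fin (N + 1)) →₀ ℕ}
    (h : s i = 0) : dX i (monomial s 1) = 0 := by
  rw [dX_monomial, h, Nat.cast_zero, zero_smul]

theorem exists_add_single {σ : Type*} {i : σ} {s : σ →₀ ℕ} (h : s i ≠ 0) :
    ∃ t, s = t + Finsupp.single i 1 := by
  classical
  refine ⟨s - Finsupp.single i 1, ?_⟩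
  ext j
  rw [Finsupp.add_apply, Finsupp.tsub_apply, Finsupp.single_apply]
  split_ifs with hj
  · subst hj; omega
  · omega

theorem dX_monomial_add (i : Option (Fin (N + 1))) (s : Option (Fin (N + 1)) →₀ ℕ) :
    dX i (monomial (s + Finsupp.single i 1) 1) = (s i + 1 : ℂ) • monomial s 1 := by
  rw [dX_monomial, add_tsub_cancel_right]
  simp

theorem isAdj_mulX_some (δ μ : ℝ) (j : Fin (N + 1)) :
    IsAdj δ μ (mulX (some j)) ((centralCoeff N (N - j) * μ) • dX (some j)) := by
  classical
  refine IsAdj.of_monomial fun s t => ?_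
  rw [mulX_monomial, polyForm_monomial, LinearMap.smul_apply]
  by_cases h : t (some j) = 0
  · rw [dX_monomial_eq_zero h, smul_zero, map_zero, if_neg]
    rintro rfl
    simp at h
  · obtain ⟨t, rfl⟩ := exists_add_single h
    rw [dX_monomial_add, map_smul, map_smul, polyForm_monomial]
    simp only [add_left_inj]
    split_ifs with hs
    · subst hs
      rw [monoNorm_add_some, ← ofReal_realCoeff, smul_eq_mul, smul_eq_mul]
      push_cast; ring
    · simp

theorem slH_monomial_add (δ : ℂ) (s : Option (Fin (N + 1)) →₀ ℕ) :
    slH N δ (monomial (s + Finsupp.single none 1) 1) =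
      ((s none + 1) * (s none - δ) : ℂ) • monomial s 1 := by
  rw [slH, LinearMap.sub_apply, LinearMap.smul_apply, Module.End.mul_apply, Module.End.mul_apply,
    dX_monomial_add, map_smul]
  by_cases h : s none = 0
  · rw [dX_monomial_eq_zero h, h]
    simp
  · obtain ⟨t, rfl⟩ := exists_add_single h
    rw [dX_monomial_add, map_smul, map_smul, mulX_monomial, Finsupp.add_apply,
      Finsupp.single_eq_same]
    push_cast
    module

theorem isAdj_mulX_none (δ μ : ℝ) : IsAdj δ μ (mulX none) (slH N δ) := by
  classical
  refine IsAdj.of_monomial fun s t => ?_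
  rw [mulX_monomial, polyForm_monomial]
  by_cases h : t none = 0
  · rw [slH, LinearMap.sub_apply, LinearMap.smul_apply, Module.End.mul_apply, dX_monomial_eq_zero h,
      map_zero, smul_zero, sub_zero, map_zero, if_neg]
    rintro rfl
    simp at h
  · obtain ⟨t, rfl⟩ := exists_add_single h
    rw [slH_monomial_add, map_smul, polyForm_monomial]
    simp only [add_left_inj]
    split_ifs with hs
    · subst hs
      rw [monoNorm_add_none, smul_eq_mul]
      push_cast; ring
    · simp

theorem isAdj_fockP (δ μ : ℝ) (n : ℕ) (hn : n < 2 * N + 2) :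
    IsAdj δ μ (fockP N μ n) (fockP N μ (2 * N + 1 - n)) := by
  obtain ⟨j, rfl⟩ | ⟨j, rfl⟩ := eq_creation_or_annihilation hn
  · rw [show 2 * N + 1 - (N - j) = N + 1 + j by omega, fockP_creation, fockP_annihilation]
    exact (isAdj_mulX_some δ μ j).symm
  · rw [show 2 * N + 1 - (N + 1 + j) = N - j by omega, fockP_creation, fockP_annihilation]
    exact isAdj_mulX_some δ μ j

/-- Taking adjoints reverses products, so P_{n+1} P_{2N+1−n} becomes P_n P_{2N−n}, the term of
`quadH` with the same n and the same real coefficient. -/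
theorem isAdj_quadC {δ μ : ℝ} {ν : ℂ} (hν : conj ν = ν) {P : ℕ → Module.End ℂ (Poly N)}
    (hP : ∀ n < 2 * N + 2, IsAdj δ μ (P n) (P (2 * N + 1 - n))) :
    IsAdj δ μ (quadC N ν P) (quadH N ν P) := by
  refine IsAdj.smul _ (by simp [hν, map_ofNat (starRingEnd ℂ) 2]) (IsAdj.sum _ fun n hn => IsAdj.smul _ (conj_quadCoeff n) ?_)
  rw [Finset.mem_range] at hn
  have := (hP (n + 1) (by omega)).mul (hP (2 * N + 1 - n) (by omega))
  rwa [show 2 * N + 1 - (2 * N + 1 - n) = n by omega,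
    show 2 * N + 1 - (n + 1) = 2 * N - n by omega] at this

theorem contravariant_of_isAdj {δ μ ν : ℝ} {C D H : Module.End ℂ (Poly N)}
    {P : ℕ → Module.End ℂ (Poly N)} (hr : IsRealization N ν C D H P) (hC : IsAdj δ μ C H)
    (hP : ∀ n < 2 * N + 2, IsAdj δ μ (P n) (P (2 * N + 1 - n))) (i : Gen N) (f g : Poly N) :
    polyForm N δ μ (hr.toLieHom (gen i) f) g =
      polyForm N δ μ f (hr.toLieHom (gen (omegaGen i)) g) := by
  rw [hr.toLieHom_gen, hr.toLieHom_gen]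
  rcases i with _ | _ | _ | _ | n <;> simp only [omegaGen, IsRealization.onGen]
  · exact hC f g
  -- D is the commutator of the mutually adjoint C and H, hence self-adjoint.
  · have := hC.lie hC.symm
    rw [hr.C_H] at this
    exact this f g
  · exact hC.symm f g
  · rw [Module.algebraMap_end_apply, Module.algebraMap_end_apply, map_smulₛₗ, map_smul,
      Complex.conj_ofReal, LinearMap.smul_apply]
  · rw [Fin.val_rev, show 2 * N + 2 - ((n : ℕ) + 1) = 2 * N + 1 - n by omega]
    exact hP n n.2 f g

theorem isShapovalov_model (δ : ℝ) {μ : ℝ} (hμ : (μ : ℂ) ≠ 0) :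
    IsShapovalov (pullback (isHighestWeight_model (N := N) δ hμ).lift
      (polyForm N (shift N δ) μ) : Form N δ μ) :=
  (isHighestWeight_model (N := N) δ hμ).isShapovalov (polyForm_one _ _)
    (contravariant_of_isAdj _ ((isAdj_mulX_none _ μ).add
      (isAdj_quadC (Complex.conj_ofReal μ) (isAdj_fockP _ μ))) (isAdj_fockP _ μ))

/-- With all P_n acting by zero there is no zero-point weight, so δ enters unshifted. -/
theorem isShapovalov_model_zero (N : ℕ) (δ : ℝ) :
    IsShapovalov (pullback (isHighestWeight_model_zero N δ).lift (polyForm N δ 0) : Form N δ 0) :=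
  (isHighestWeight_model_zero N δ).isShapovalov (polyForm_one _ _)
    (contravariant_of_isAdj (ν := 0) (by simpa using isRealization_model_zero N δ)
      ((isAdj_mulX_none δ 0).add IsAdj.zero) fun _ _ => IsAdj.zero)

theorem existsUnique_isShapovalov (N : ℕ) (δ μ : ℝ) : ∃! B : Form N δ μ, IsShapovalov B := by
  by_cases hμ : μ = 0
  · subst hμ
    exact ⟨_, isShapovalov_model_zero N δ, fun B hB => hB.unique (isShapovalov_model_zero N δ)⟩
  · have hμ' : (μ : ℂ) ≠ 0 := by exact_mod_cast hμ
    exact ⟨_, isShapovalov_model δ hμ', fun B hB => hB.unique (isShapovalov_model δ hμ')⟩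

end

/-! ### Unitriangularity of the basis vectors against the monomials -/

section

open MvPolynomial

variable {N : ℕ}

/-- The level of a monomial. -/
def weight (s : Option (Fin (N + 1)) →₀ ℕ) : ℕ :=
  2 * s none + ∑ j : Fin (N + 1), (2 * (j : ℕ) + 1) * s (some j)

theorem weight_add (s t : Option (Fin (N + 1)) →₀ ℕ) : weight (s + t) = weight s + weight t := by
  simp only [weight, Finsupp.add_apply, mul_add, Finset.sum_add_distrib]; ring

theorem weight_single_none (h : ℕ) :
    weight (Finsupp.single none h : Option (Fin (N + 1)) →₀ ℕ) = 2 * h := by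
  simp [weight]

theorem weight_single_some (j : Fin (N + 1)) :
    weight (Finsupp.single (some j) 1 : Option (Fin (N + 1)) →₀ ℕ) = 2 * j + 1 := by
  classical
  simp [weight, Finsupp.single_apply]

/-- The span of the monomials of level `w` and of degree less than `h` in the variable `none`. -/
def lowSpan (N : ℕ) (w : ℤ) (h : ℕ) : Submodule ℂ (Poly N) :=
  Submodule.span ℂ {f | ∃ s, (weight s : ℤ) = w ∧ s none < h ∧ f = monomial s 1}

theorem monomial_mem_lowSpan {s : Option (Fin (N + 1)) →₀ ℕ} {w : ℤ} {h : ℕ} (hs : (weight s : ℤ) = w)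
    (hh : s none < h) : monomial s 1 ∈ lowSpan N w h :=
  Submodule.subset_span ⟨s, hs, hh, rfl⟩

theorem map_mem_lowSpan {A : Module.End ℂ (Poly N)} {w w' : ℤ} {h h' : ℕ}
    (hA : ∀ s, (weight s : ℤ) = w → s none < h → A (monomial s 1) ∈ lowSpan N w' h') {f : Poly N}
    (hf : f ∈ lowSpan N w h) : A f ∈ lowSpan N w' h' := by
  induction hf using Submodule.span_induction with
  | mem f hf => obtain ⟨s, hs, hh, rfl⟩ := hf; exact hA s hs hh
  | zero => rw [map_zero]; exact Submodule.zero_mem _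
  | add a b _ _ ha hb => rw [map_add]; exact Submodule.add_mem _ ha hb
  | smul c a _ ha => rw [map_smul]; exact Submodule.smul_mem _ c ha

theorem coeff_eq_zero_of_mem_lowSpan {w : ℤ} {h : ℕ} {f : Poly N} (hf : f ∈ lowSpan N w h)
    {s : Option (Fin (N + 1)) →₀ ℕ} (hs : ¬ ((weight s : ℤ) = w ∧ s none < h)) :
    coeff s f = 0 := by
  classical
  induction hf using Submodule.span_induction with
  | mem f hf =>
    obtain ⟨t, ht, hh, rfl⟩ := hf
    rw [coeff_monomial, if_neg]
    rintro rfl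
    exact hs ⟨ht, hh⟩
  | zero => rw [coeff_zero]
  | add a b _ _ ha hb => rw [coeff_add, ha, hb, add_zero]
  | smul c a _ ha => rw [coeff_smul, ha, smul_zero]

/-- The operators P_n do not touch the variable `none`. Levels are integers here because
annihilation lowers them. -/
theorem fockP_mem_lowSpan {μ : ℂ} {n : ℕ} (hn : n < 2 * N + 2) {w : ℤ} {h : ℕ} {f : Poly N}
    (hf : f ∈ lowSpan N w h) : fockP N μ n f ∈ lowSpan N (w + (2 * n - 2 * N - 1)) h := by
  refine map_mem_lowSpan (fun s hs hh => ?_) hf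
  obtain ⟨j, rfl⟩ | ⟨j, rfl⟩ := eq_creation_or_annihilation hn
  · rw [fockP_annihilation, LinearMap.smul_apply]
    refine Submodule.smul_mem _ _ ?_
    by_cases h0 : s (some j) = 0
    · rw [dX_monomial_eq_zero h0]; exact Submodule.zero_mem _
    · obtain ⟨t, rfl⟩ := exists_add_single h0
      rw [dX_monomial_add]
      rw [weight_add, weight_single_some] at hs
      refine Submodule.smul_mem _ _ (monomial_mem_lowSpan ?_ ?_)
      · have := j.2
        push_cast at hs ⊢
        omega
      · simpa using hh
  · rw [fockP_creation, mulX_monomial]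
    refine monomial_mem_lowSpan ?_ (by simpa using hh)
    rw [weight_add, weight_single_some]
    push_cast
    omega

theorem quadC_mem_lowSpan {μ : ℂ} {w : ℤ} {h : ℕ} {f : Poly N} (hf : f ∈ lowSpan N w h) :
    quadC N μ (fockP N μ) f ∈ lowSpan N (w + 2) h := by
  rw [quadC, LinearMap.smul_apply, LinearMap.sum_apply]
  refine Submodule.smul_mem _ _ (Submodule.sum_mem _ fun n hn => ?_)
  rw [Finset.mem_range] at hn
  rw [LinearMap.smul_apply, Module.End.mul_apply]
  refine Submodule.smul_mem _ _ ?_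
  have := fockP_mem_lowSpan (μ := μ) (n := n + 1) (by omega)
    (fockP_mem_lowSpan (μ := μ) (n := 2 * N + 1 - n) (by omega) hf)
  convert this using 2
  push_cast
  omega

theorem mulX_none_mem_lowSpan {w : ℤ} {h : ℕ} {f : Poly N} (hf : f ∈ lowSpan N w h) :
    mulX none f ∈ lowSpan N (w + 2) (h + 1) := by
  refine map_mem_lowSpan (fun s hs hh => ?_) hf
  rw [mulX_monomial]
  refine monomial_mem_lowSpan ?_ (by simpa using hh)
  rw [weight_add, weight_single_none]
  push_cast
  omega

theorem lowSpan_mono {w : ℤ} {h : ℕ} : lowSpan N w h ≤ lowSpan N w (h + 1) := by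
  refine Submodule.span_le.2 ?_
  rintro _ ⟨s, hs, hh, rfl⟩
  exact monomial_mem_lowSpan hs (by omega)

/-- The operator `C` of the polynomial model. -/
def modelC (N : ℕ) (μ : ℂ) : Module.End ℂ (Poly N) := mulX none + quadC N μ (fockP N μ)

/-- Both summands of `modelC` raise the level by 2, but only multiplication by `none` raises the
degree in `none`. The leading term thus uses that summand h times. -/
theorem pow_apply_monomial (μ : ℂ) {s : Option (Fin (N + 1)) →₀ ℕ} (hs : s none = 0) (h : ℕ) :
    (modelC N μ ^ h) (monomial s 1) -
      monomial (s + Finsupp.single none h) 1 ∈ lowSpan N (weight s + 2 * h) h := by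
  induction h with
  | zero => simp
  | succ h ih =>
    rw [pow_succ', Module.End.mul_apply]
    set f := (modelC N μ ^ h) (monomial s 1) with hf
    have e : modelC N μ f -
        monomial (s + Finsupp.single none (h + 1)) 1 =
        (mulX none (f - monomial (s + Finsupp.single none h) 1) +
        quadC N μ (fockP N μ) (f - monomial (s + Finsupp.single none h) 1)) +
        quadC N μ (fockP N μ) (monomial (s + Finsupp.single none h) 1) := by
      rw [map_sub, map_sub, mulX_monomial, modelC, LinearMap.add_apply, add_assoc s, ← Finsupp.single_add]
      abel
    rw [e, show ((weight s : ℤ) + 2 * (h + 1 : ℕ)) = weight s + 2 * h + 2 by push_cast; ring]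
    refine Submodule.add_mem _ (Submodule.add_mem _ (mulX_none_mem_lowSpan ih)
      (lowSpan_mono (quadC_mem_lowSpan ih))) (quadC_mem_lowSpan (monomial_mem_lowSpan ?_ ?_))
    · rw [weight_add, weight_single_none]; push_cast; ring
    · simp [hs]

/-- The exponents of the monomial with a given label. -/
def labelExp (h : ℕ) (k : Fin (N + 1) → ℕ) : Option (Fin (N + 1)) →₀ ℕ :=
  Finsupp.equivFunOnFinite.symm fun o => o.elim h k

theorem labelExp_none (h : ℕ) (k : Fin (N + 1) → ℕ) : labelExp h k none = h := rfl

theorem labelExp_some (h : ℕ) (k : Fin (N + 1) → ℕ) (j : Fin (N + 1)) :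
    labelExp h k (some j) = k j := rfl

theorem labelExp_add_single (h : ℕ) (k : Fin (N + 1) → ℕ) :
    labelExp 0 k + Finsupp.single none h = labelExp h k := by
  classical
  ext i
  rcases i with _ | j
  · simp [labelExp_none]
  · simp [labelExp_some]

theorem weight_labelExp {m : ℕ} (p : Label N m) : weight (labelExp p.1.1 p.1.2) = m := p.2

theorem labelExp_injective {m : ℕ} :
    Function.Injective fun p : Label N m => labelExp p.1.1 p.1.2 := by
  intro p q h
  refine Subtype.ext (Prod.ext ?_ (funext fun j => ?_))
  · exact DFunLike.congr_fun h none
  · exact DFunLike.congr_fun h (some j)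

theorem exists_label {m : ℕ} {s : Option (Fin (N + 1)) →₀ ℕ} (hs : weight s = m) :
    ∃ p : Label N m, labelExp p.1.1 p.1.2 = s := by
  refine ⟨⟨(s none, fun j => s (some j)), hs⟩, ?_⟩
  ext i
  rcases i with _ | j <;> rfl

theorem prod_mulX_one (k : Fin (N + 1) → ℕ) :
    (List.ofFn fun j : Fin (N + 1) => (mulX (some j) : Module.End ℂ (Poly N)) ^ k j).prod 1 =
      monomial (labelExp 0 k) 1 := by
  have h1 (j : Fin (N + 1)) : (mulX (some j) : Module.End ℂ (Poly N)) ^ k j =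
      Algebra.lmul ℂ (Poly N) (X (some j) ^ k j) := by
    rw [map_pow]; rfl
  have h2 : (List.ofFn fun j : Fin (N + 1) => (mulX (some j) : Module.End ℂ (Poly N)) ^ k j).prod =
      Algebra.lmul ℂ (Poly N) (∏ j, X (some j) ^ k j) := by
    rw [← List.prod_ofFn, map_list_prod, List.map_ofFn]
    congr 2
    funext j
    exact h1 j
  rw [h2, Algebra.coe_lmul_eq_mul, LinearMap.mul_apply', mul_one, monomial_eq, C_1, one_mul,
    Finsupp.prod_fintype _ _ (by simp), Fintype.prod_option, labelExp_none, pow_zero, one_mul]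
  rfl

section Transition

variable (δ : ℝ) {μ : ℝ} (hμ : (μ : ℂ) ≠ 0)

/-- The image of a basis vector in the polynomial model. -/
def vecImage {m : ℕ} (p : Label N m) : Poly N :=
  (isHighestWeight_model (N := N) δ hμ).lift (vec δ μ p)

theorem vecImage_eq {m : ℕ} (p : Label N m) : vecImage δ hμ p =
    (modelC N μ ^ p.1.1) (monomial (labelExp 0 p.1.2) 1) := by
  rw [vecImage, map_vec (ρ := fun i => (isRealization_model (shift N δ : ℝ) hμ).toLieHom (gen i)) _
    fun i _ x => IsHighestWeight.lift_smul _ (gen i) x, IsHighestWeight.lift_hwv]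
  simp only [IsRealization.toLieHom_gen, IsRealization.onGen, fockP_creation]
  rw [prod_mulX_one]
  rfl

theorem vecImage_sub_mem {m : ℕ} (p : Label N m) :
    vecImage δ hμ p - monomial (labelExp p.1.1 p.1.2) 1 ∈ lowSpan N m p.1.1 := by
  have h := pow_apply_monomial (μ : ℂ) (labelExp_none 0 p.1.2) p.1.1
  rw [labelExp_add_single, ← vecImage_eq δ hμ] at h
  have e : ((weight (labelExp 0 p.1.2) : ℤ) + 2 * p.1.1) = m := by
    have h1 := weight_labelExp p
    rw [← labelExp_add_single p.1.1, weight_add, weight_single_none] at h1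
    exact_mod_cast h1
  rwa [e] at h

/-- The transition matrix from the monomials to the images of the basis vectors. -/
def transition (m : ℕ) : Matrix (Label N m) (Label N m) ℂ :=
  Matrix.of fun p q => coeff (labelExp q.1.1 q.1.2) (vecImage δ hμ p)

theorem transition_apply {m : ℕ} (p q : Label N m) (h : p.1.1 ≤ q.1.1) :
    transition δ hμ m p q = if p = q then 1 else 0 := by
  classical
  have h1 := coeff_eq_zero_of_mem_lowSpan (vecImage_sub_mem δ hμ p)
    (s := labelExp q.1.1 q.1.2) (by rw [labelExp_none]; omega)
  rw [coeff_sub, sub_eq_zero] at h1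
  rw [transition, Matrix.of_apply, h1, coeff_monomial]
  by_cases hpq : p = q
  · rw [if_pos hpq, if_pos (by rw [hpq])]
  · rw [if_neg hpq, if_neg fun e => hpq (labelExp_injective e)]

/-- Labels are grouped by the exponent of C. The order is reversed because entries vanish when the
column has the larger exponent; each diagonal block is the identity. -/
theorem det_transition (m : ℕ) : (transition (N := N) δ hμ m).det = 1 := by
  classical
  have hT : (transition (N := N) δ hμ m).BlockTriangular fun p => OrderDual.toDual p.1.1 := by
    intro p q hpq
    have hlt : p.1.1 < q.1.1 := hpq
    rw [transition_apply δ hμ p q hlt.le, if_neg]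
    rintro rfl
    exact lt_irrefl _ hlt
  rw [hT.det]
  refine Finset.prod_eq_one fun a _ => ?_
  have : (transition (N := N) δ hμ m).toSquareBlock (fun p => OrderDual.toDual p.1.1) a = 1 := by
    ext p q
    have h : (p : Label N m).1.1 = (q : Label N m).1.1 :=
      OrderDual.toDual.injective (p.2.trans q.2.symm)
    rw [Matrix.toSquareBlock_def, Matrix.of_apply, transition_apply δ hμ _ _ h.le, Matrix.one_apply]
    simp only [Subtype.ext_iff]
  rw [this, Matrix.det_one]

theorem vecImage_eq_sum {m : ℕ} (p : Label N m) :
    vecImage δ hμ p = ∑ q, transition δ hμ m p q • monomial (labelExp q.1.1 q.1.2) 1 := by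
  classical
  ext s
  rw [coeff_sum]
  simp only [coeff_smul, coeff_monomial, smul_eq_mul, mul_ite, mul_one, mul_zero]
  by_cases hs : weight s = m
  · obtain ⟨q, rfl⟩ := exists_label hs
    rw [Finset.sum_eq_single q]
    · rw [if_pos rfl]; rfl
    · intro b _ hb
      rw [if_neg fun e => hb (labelExp_injective e)]
    · intro h; exact absurd (Finset.mem_univ q) h
  · rw [Finset.sum_eq_zero]
    · have h1 := coeff_eq_zero_of_mem_lowSpan (vecImage_sub_mem δ hμ p) (s := s) (by
        intro h; exact hs (by exact_mod_cast h.1))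
      rw [coeff_sub, sub_eq_zero, coeff_monomial, if_neg] at h1
      · exact h1
      · rintro rfl; exact hs (weight_labelExp p)
    · intro q _
      rw [if_neg]
      rintro rfl; exact hs (weight_labelExp q)

include hμ in
theorem linearIndependent_vec_of_ne_zero (m : ℕ) :
    LinearIndependent ℂ fun p : Label N m => vec δ μ p := by
  classical
  have h1 : LinearIndependent ℂ (transition (N := N) δ hμ m).row :=
    Matrix.linearIndependent_rows_of_det_ne_zero (A := transition (N := N) δ hμ m)
      (by rw [det_transition]; exact one_ne_zero)
  let c : Poly N →ₗ[ℂ] (Label N m → ℂ) :=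
    LinearMap.pi fun q => lcoeff ℂ (labelExp q.1.1 q.1.2)
  exact LinearIndependent.of_comp (c ∘ₗ (isHighestWeight_model (N := N) δ hμ).lift) h1

include hμ in
/-- The Kac determinant is the product of the squared norms of the labels. -/
theorem kacDet_eq_prod (m : ℕ) {B : Form N δ μ} (hB : IsShapovalov B) :
    kacDet B m = ∏ p : Label N m, (labelNorm N (shift N δ) μ p.1.1 p.1.2 : ℂ) := by
  classical
  rw [hB.unique (isShapovalov_model δ hμ)]
  -- The Gram matrix is the conjugate of T times a diagonal matrix times the transpose of T, with T
  -- the transition matrix; the conjugate comes from the first variable of the form.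
  have : (Matrix.of fun p q : Label N m => pullback (isHighestWeight_model (N := N) δ hμ).lift
      (polyForm N (shift N δ) μ) (vec δ μ p) (vec δ μ q)) =
      (transition δ hμ m).map (starRingEnd ℂ) *
        Matrix.diagonal (fun p : Label N m => (labelNorm N (shift N δ) μ p.1.1 p.1.2 : ℂ)) *
        (transition δ hμ m).transpose := by
    ext p q
    rw [Matrix.of_apply, pullback_apply]
    change polyForm N (shift N δ) μ (vecImage δ hμ p) (vecImage δ hμ q) = _
    rw [vecImage_eq_sum δ hμ p, map_sum, LinearMap.sum_apply, Matrix.mul_apply]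
    refine Finset.sum_congr rfl fun r _ => ?_
    rw [map_smulₛₗ, LinearMap.smul_apply, polyForm_monomial_left, Matrix.mul_diagonal,
      Matrix.map_apply, Matrix.transpose_apply, smul_eq_mul, mul_assoc]
    rfl
  rw [kacDet, this, Matrix.det_mul, Matrix.det_mul, Matrix.det_transpose, det_transition, mul_one,
    Matrix.det_diagonal]
  have h2 : ((transition (N := N) δ hμ m).map (starRingEnd ℂ)).det = 1 := by
    have := (RingHom.map_det (starRingEnd ℂ) (transition (N := N) δ hμ m)).symm
    rw [det_transition, map_one] at this
    exact this
  rw [h2, one_mul]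

end Transition

/-- For μ = 0, write 0 = 1 + (−1): `lowerMap` carries the basis vectors to those of weight (δ, 1),
where the polynomial model proves independence. -/
theorem linearIndependent_vec (N : ℕ) (δ μ : ℝ) (m : ℕ) :
    LinearIndependent ℂ fun p : Label N m => vec δ μ p := by
  by_cases hμ : μ = 0
  · obtain ⟨B, hB, -⟩ := existsUnique_isShapovalov N 0 (-1)
    have h1 : LinearIndependent ℂ fun p : Label N m => vec (δ + 0) (1 + -1) p := by
      refine LinearIndependent.of_comp (lowerMap δ 1 B) ?_
      convert linearIndependent_vec_of_ne_zero (N := N) δ (μ := 1) (by simp) m using 1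
      funext p
      exact lowerMap_vec hB p
    rw [add_zero, add_neg_cancel, ← hμ] at h1
    exact h1
  · exact linearIndependent_vec_of_ne_zero δ (by exact_mod_cast hμ) m

theorem finrank_level (N : ℕ) (δ μ : ℝ) (m : ℕ) :
    Module.finrank ℂ (level N δ μ m) = dimLevel N m :=
  finrank_span_eq_card (linearIndependent_vec N δ μ m)

end

/-! ### Counting labels, the product formula and root multiplicities -/

section

variable {N : ℕ}

/-- Removing i + 1 factors C is a bijection. The bound on i keeps m − 2(i+1) from being truncated.
-/
theorem card_label_lt {m i : ℕ} (hi : i < m / 2) :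
    (Finset.univ.filter fun p : Label N m => i < p.1.1).card = dimLevel N (m - 2 * (i + 1)) := by
  rw [← Fintype.card_subtype, dimLevel]
  refine Fintype.card_congr ⟨fun p => ⟨(p.1.1.1 - (i + 1), p.1.1.2), ?_⟩,
    fun p => ⟨⟨(p.1.1 + (i + 1), p.1.2), ?_⟩, ?_⟩, fun p => ?_, fun p => ?_⟩
  · have h1 := p.1.2
    have h2 := p.2
    simp only at h1 ⊢
    omega
  · have h1 := p.2
    simp only at h1 ⊢
    omega
  · simp only; omega
  · have h2 := p.2
    refine Subtype.ext (Subtype.ext (Prod.ext ?_ rfl))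
    simp only
    omega
  · refine Subtype.ext (Prod.ext ?_ rfl)
    simp only
    omega

/-- Interchange the two products: g i occurs once for every label whose exponent of C exceeds i. -/
theorem prod_label_prod_range (m : ℕ) (g : ℕ → ℝ) :
    ∏ p : Label N m, ∏ i ∈ Finset.range p.1.1, g i =
      ∏ i ∈ Finset.range (m / 2), g i ^ dimLevel N (m - 2 * (i + 1)) := by
  have h1 (p : Label N m) : ∏ i ∈ Finset.range p.1.1, g i =
      ∏ i ∈ Finset.range (m / 2), if i < p.1.1 then g i else 1 := by
    rw [← Finset.prod_filter]
    refine Finset.prod_congr ?_ fun _ _ => rfl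
    ext i
    have := p.2
    rw [Finset.mem_filter, Finset.mem_range, Finset.mem_range]
    omega
  rw [Finset.prod_congr rfl fun p _ => h1 p, Finset.prod_comm]
  refine Finset.prod_congr rfl fun i hi => ?_
  rw [← Finset.prod_filter, Finset.prod_const, card_label_lt (Finset.mem_range.1 hi)]

/-- The factor of the squared norm of a basis vector that does not depend on `δ`. -/
def labelFactor (N : ℕ) (μ : ℝ) (h : ℕ) (k : Fin (N + 1) → ℕ) : ℝ :=
  ((h.factorial : ℝ) * (-1 / 2) ^ h) *
    ∏ j : Fin (N + 1), ((k j).factorial : ℝ) * (realCoeff N (N - j) * μ) ^ k j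

/-- Each factor i − `shift N δ` is −1/2 times the corresponding linear factor of the theorem, since
N + 1 = ℓ + 1/2. -/
theorem labelNorm_eq (δ μ : ℝ) (h : ℕ) (k : Fin (N + 1) → ℕ) :
    labelNorm N (shift N δ) μ h k = labelFactor N μ h k *
      ∏ i ∈ Finset.range h, (2 * δ - 2 * (i : ℝ) + (spin N + 1 / 2) ^ 2) := by
  have : ∏ i ∈ Finset.range h, ((i : ℝ) - shift N δ) = (-1 / 2) ^ h *
      ∏ i ∈ Finset.range h, (2 * δ - 2 * (i : ℝ) + (spin N + 1 / 2) ^ 2) := by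
    have hc : (-1 / 2 : ℝ) ^ h = ∏ _i ∈ Finset.range h, (-1 / 2 : ℝ) := by
      rw [Finset.prod_const, Finset.card_range]
    rw [hc, ← Finset.prod_mul_distrib]
    refine Finset.prod_congr rfl fun i _ => ?_
    rw [shift, spin]; ring
  rw [labelNorm, labelFactor, this]; ring

theorem labelFactor_ne_zero {μ : ℝ} (hμ : μ ≠ 0) (h : ℕ) (k : Fin (N + 1) → ℕ) :
    labelFactor N μ h k ≠ 0 := by
  refine mul_ne_zero (mul_ne_zero (by positivity) (pow_ne_zero _ (by norm_num)))
    (Finset.prod_ne_zero_iff.2 fun j _ => ?_)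
  exact mul_ne_zero (by positivity) (pow_ne_zero _ (mul_ne_zero (realCoeff_ne_zero _ _) hμ))

/-- The label of the vector `P (ℓ + 1/2) ^ m v`. -/
def firstLabel (N m : ℕ) : Label N m :=
  ⟨(0, Pi.single 0 m), by
    rw [Finset.sum_eq_single 0]
    · simp
    · intro j _ hj; simp [hj]
    · simp⟩

theorem labelFactor_firstLabel {m : ℕ} (hm : m ≠ 0) :
    labelFactor N 0 (firstLabel N m).1.1 (firstLabel N m).1.2 = 0 := by
  rw [labelFactor, Finset.prod_eq_zero (Finset.mem_univ 0), mul_zero]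
  simp [firstLabel, hm]

/-- The vector P_{ℓ+1/2}^m v lies in the radical, as it maps to zero in the model where the P_n act
by zero; this gives a zero row. -/
theorem kacDet_zero_right {δ : ℝ} {B : Form N δ 0} (hB : IsShapovalov B) {m : ℕ} (hm : m ≠ 0) :
    kacDet B m = 0 := by
  refine Matrix.det_eq_zero_of_row_eq_zero (firstLabel N m) fun q => ?_
  rw [Matrix.of_apply, hB.unique (isShapovalov_model_zero N δ), pullback_apply]
  have : (isHighestWeight_model_zero N δ).lift (vec δ 0 (firstLabel N m)) = 0 := by
    rw [map_vec (ρ := fun i => (isRealization_model_zero N δ).toLieHom (gen i)) _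
      fun i _ x => IsHighestWeight.lift_smul _ (gen i) x]
    simp only [IsRealization.toLieHom_gen, IsRealization.onGen]
    rw [List.ofFn_succ, List.prod_cons]
    simp [firstLabel, hm]
  rw [this, map_zero, LinearMap.zero_apply]

theorem kacDet_zero {δ μ : ℝ} {B : Form N δ μ} (hB : IsShapovalov B) : kacDet B 0 = 1 := by
  have hs : Subsingleton (Label N 0) := by
    have h0 (p : Label N 0) : p.1 = (0, fun _ => 0) := by
      have h := p.2
      rw [Nat.add_eq_zero_iff, Finset.sum_eq_zero_iff] at h
      refine Prod.ext (by simpa using h.1) (funext fun j => ?_)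
      have := h.2 j (Finset.mem_univ j)
      rw [Nat.mul_eq_zero] at this
      exact this.resolve_left (by omega)
    exact ⟨fun p q => Subtype.ext ((h0 p).trans (h0 q).symm)⟩
  have hv : vec δ μ (firstLabel N 0) = hwv N δ μ := by
    simp [vec, firstLabel]
  rw [kacDet, Matrix.det_eq_elem_of_subsingleton _ (firstLabel N 0), Matrix.of_apply, hv,
    hB.hwv_hwv]

/-- The `δ`-independent factor of the Kac determinant. -/
def kacFactor (N m : ℕ) (μ : ℝ) : ℝ :=
  if m = 0 then 1 else ∏ p : Label N m, labelFactor N μ p.1.1 p.1.2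

theorem kacFactor_ne_zero (m : ℕ) {μ : ℝ} (hμ : μ ≠ 0) : kacFactor N m μ ≠ 0 := by
  rw [kacFactor]
  split_ifs
  · exact one_ne_zero
  · exact Finset.prod_ne_zero_iff.2 fun p _ => labelFactor_ne_zero hμ _ _

/-- When μ = 0 and m > 0 both sides vanish, the right one through the δ-independent factor of the
same label that gives the zero row. -/
theorem kacDet_eq (m : ℕ) (δ μ : ℝ) (B : Form N δ μ) (hB : IsShapovalov B) :
    kacDet B m = ((kacFactor N m μ * ∏ j ∈ Finset.range (m / 2),
      (2 * δ - 2 * (j : ℝ) + (spin N + 1 / 2) ^ 2) ^ dimLevel N (m - 2 * (j + 1)) : ℝ) : ℂ) := by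
  by_cases hm : m = 0
  · subst hm
    rw [kacDet_zero hB]
    simp [kacFactor]
  rw [kacFactor, if_neg hm]
  by_cases hμ : μ = 0
  · subst hμ
    rw [kacDet_zero_right hB hm,
      Finset.prod_eq_zero (Finset.mem_univ (firstLabel N m)) (labelFactor_firstLabel hm), zero_mul,
      Complex.ofReal_zero]
  · rw [kacDet_eq_prod δ (by exact_mod_cast hμ) m hB, ← Complex.ofReal_prod,
      ← prod_label_prod_range m fun j => 2 * δ - 2 * (j : ℝ) + (spin N + 1 / 2) ^ 2,
      ← Finset.prod_mul_distrib]
    congr 1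
    exact Finset.prod_congr rfl fun p _ => labelNorm_eq δ μ _ _

open Polynomial in
/-- The Kac determinant as a polynomial in `δ`. -/
def kacPoly (N m : ℕ) (μ : ℝ) : Polynomial ℝ :=
  C (kacFactor N m μ) * ∏ j ∈ Finset.range (m / 2),
    (C 2 * X + C ((spin N + 1 / 2) ^ 2 - 2 * (j : ℝ))) ^ dimLevel N (m - 2 * (j + 1))

theorem eval_kacPoly (m : ℕ) (δ μ : ℝ) : (kacPoly N m μ).eval δ =
    kacFactor N m μ * ∏ j ∈ Finset.range (m / 2),
      (2 * δ - 2 * (j : ℝ) + (spin N + 1 / 2) ^ 2) ^ dimLevel N (m - 2 * (j + 1)) := by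
  rw [kacPoly, Polynomial.eval_mul, Polynomial.eval_C, Polynomial.eval_prod]
  congr 1
  refine Finset.prod_congr rfl fun j _ => ?_
  simp only [Polynomial.eval_pow, Polynomial.eval_add, Polynomial.eval_mul, Polynomial.eval_C,
    Polynomial.eval_X]
  congr 1
  ring

theorem kacPoly_ne_zero (m : ℕ) {μ : ℝ} (hμ : μ ≠ 0) : kacPoly N m μ ≠ 0 := by
  refine mul_ne_zero (Polynomial.C_ne_zero.2 (kacFactor_ne_zero m hμ))
    (Finset.prod_ne_zero_iff.2 fun j _ => pow_ne_zero _ fun h => ?_)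
  have := congrArg (fun p => p.coeff 1) h
  rw [Polynomial.coeff_add, Polynomial.coeff_C_mul, Polynomial.coeff_X_one, Polynomial.coeff_C] at this
  simp at this

-- The linear factors have pairwise distinct roots, so after splitting off the factor with index q −
-- 1 the cofactor g does not vanish at r.
open Polynomial in
theorem rootMultiplicity_kacPoly (m : ℕ) {μ : ℝ} (hμ : μ ≠ 0) {q : ℕ} (hq : 1 ≤ q)
    (hqm : 2 * q ≤ m) :
    (kacPoly N m μ).rootMultiplicity ((q : ℝ) - 1 - (spin N + 1 / 2) ^ 2 / 2) =
      dimLevel N (m - 2 * q) := by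
  obtain ⟨i, rfl⟩ : ∃ i, q = i + 1 := ⟨q - 1, by omega⟩
  set r : ℝ := ((i + 1 : ℕ) : ℝ) - 1 - (spin N + 1 / 2) ^ 2 / 2 with hr
  have hi : i ∈ Finset.range (m / 2) := Finset.mem_range.2 (by omega)
  have hfac : (C 2 * X + C ((spin N + 1 / 2) ^ 2 - 2 * (i : ℝ)) : ℝ[X]) = C 2 * (X - C r) := by
    rw [mul_sub, ← C_mul, sub_eq_add_neg (C 2 * X) (C (2 * r)), ← C_neg]
    congr 2
    rw [hr]
    push_cast
    ring
  set d := dimLevel N (m - 2 * (i + 1)) with hd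
  set g : ℝ[X] := C (kacFactor N m μ) * C 2 ^ d * ∏ j ∈ (Finset.range (m / 2)).erase i,
    (C 2 * X + C ((spin N + 1 / 2) ^ 2 - 2 * (j : ℝ))) ^ dimLevel N (m - 2 * (j + 1)) with hg
  have hp : kacPoly N m μ = g * (X - C r) ^ d := by
    rw [kacPoly, ← Finset.mul_prod_erase _ _ hi, hfac, mul_pow, ← hd, hg]
    ring
  have hge : g.eval r ≠ 0 := by
    rw [hg, eval_mul, eval_mul, eval_pow, eval_C, eval_C, eval_prod]
    refine mul_ne_zero (mul_ne_zero (kacFactor_ne_zero m hμ) (pow_ne_zero _ two_ne_zero))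
      (Finset.prod_ne_zero_iff.2 fun j hj => ?_)
    rw [eval_pow]
    refine pow_ne_zero _ ?_
    simp only [eval_add, eval_mul, eval_C, eval_X]
    have hne : (i : ℝ) ≠ j := by exact_mod_cast (Finset.ne_of_mem_erase hj).symm
    intro h
    apply hne
    rw [hr] at h
    push_cast at h
    linarith
  have hg0 : g ≠ 0 := by
    intro h; rw [h, eval_zero] at hge; exact hge rfl
  rw [hp, rootMultiplicity_mul_X_sub_C_pow hg0, rootMultiplicity_eq_zero hge, zero_add]

end

end

end ConformalGalilei

theorem theorem11 (N m : ℕ) :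
    (∀ (δ μ : ℝ) (k : ℕ), Module.finrank ℂ (ConformalGalilei.level N δ μ k) =
      ConformalGalilei.dimLevel N k) ∧
    (∀ δ μ : ℝ, ∃! B : ConformalGalilei.Form N δ μ, ConformalGalilei.IsShapovalov B) ∧
    (∃ f : ℝ → ℝ, (∀ μ : ℝ, μ ≠ 0 → f μ ≠ 0) ∧
      ∀ (δ μ : ℝ) (B : ConformalGalilei.Form N δ μ), ConformalGalilei.IsShapovalov B →
        ConformalGalilei.kacDet B m =
          ((f μ * ∏ j ∈ Finset.range (m / 2),
            (2 * δ - 2 * (j : ℝ) + (ConformalGalilei.spin N + 1 / 2) ^ 2) ^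
              ConformalGalilei.dimLevel N (m - 2 * (j + 1)) : ℝ) : ℂ)) ∧
    (∀ μ : ℝ, μ ≠ 0 → ∃ p : Polynomial ℝ, p ≠ 0 ∧
      (∀ (δ : ℝ) (B : ConformalGalilei.Form N δ μ), ConformalGalilei.IsShapovalov B →
        ConformalGalilei.kacDet B m = ((p.eval δ : ℝ) : ℂ)) ∧
      ∀ q : ℕ, 1 ≤ q → 2 * q ≤ m →
        p.rootMultiplicity ((q : ℝ) - 1 - (ConformalGalilei.spin N + 1 / 2) ^ 2 / 2) =
          ConformalGalilei.dimLevel N (m - 2 * q)) := by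
  refine ⟨ConformalGalilei.finrank_level N, ConformalGalilei.existsUnique_isShapovalov N,
    ⟨ConformalGalilei.kacFactor N m, fun μ hμ => ConformalGalilei.kacFactor_ne_zero m hμ,
      ConformalGalilei.kacDet_eq m⟩, fun μ hμ => ⟨ConformalGalilei.kacPoly N m μ,
      ConformalGalilei.kacPoly_ne_zero m hμ, fun δ B hB => ?_,
      fun q hq hqm => ConformalGalilei.rootMultiplicity_kacPoly m hμ hq hqm⟩⟩
  rw [ConformalGalilei.eval_kacPoly]
  exact ConformalGalilei.kacDet_eq m δ μ B hB
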